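/- Let $N\ge 1$. A two-coloured partition $p$ with $k$ upper and $l$ lower points is a partition of these $k+l$ points into blocks together with colour words $\omega\in\{1,*\}^k$ (upper points) and $\omega'\in\{1,*\}^l$ (lower points), where $1$ is white and $*$ is black. A category of partitions is a set of two-coloured partitions that is closed under tensor product (horizontal concatenation), involution (reflection at the horizontal axis) and composition (vertical concatenation along equal colour words), and that contains the white and the black identity partition and the four mixed-coloured pair partitions (one block of two points of different colours, both lower or both upper, in either order). Let $\langle\Pi\rangle$ be the smallest category of partitions containing $\Pi$. For $p$ as above let $r=N^{tb(p)}$, where $tb(p)$ is the number of blocks with both upper and lower points (through-blocks). A labeling of a row of $p$ by elements of $[N]=\{1,\dots,N\}$ is valid if connected points have equal labels. Let $T_0\subseteq[N]^k$ and $T'_0\subseteq[N]^l$ be the invalid labelings of the upper and lower row, and for the $i$-th of the $r$ labelings of the through-blocks let $T_i$ and $T'_i$ be the valid labelings of the upper and lower row that restrict to it. For $x=(x_{ij})_{i,j\in[N]}$ let $R^{Sp}_p(x)$ be the relations $$\sum_{t\in T_i}x_{t_1\gamma_1}^{\omega_1}\cdots x_{t_k\gamma_k}^{\omega_k}=\sum_{t'\in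 T'_i}x_{t'_1\gamma'_1}^{\omega'_1}\cdots x_{t'_l\gamma'_l}^{\omega'_l}\quad(1\le i,j\le r,\ \gamma\in T_j,\ \gamma'\in T'_j),$$ $$\sum_{t\in T_i}x_{t_1\gamma_1}^{\omega_1}\cdots x_{t_k\gamma_k}^{\omega_k}=0\quad(\gamma\in T_0),\qquad \sum_{t'\in T'_i}x_{t'_1\gamma'_1}^{\omega'_1}\cdots x_{t'_l\gamma'_l}^{\omega'_l}=0\quad(\gamma'\in T'_0)\qquad(1\le i\le r),$$ an empty product being $1$. For a set $\Pi$ of two-coloured partitions containing the four mixed-coloured pair partitions, let $C(X_{N,N}(\Pi))$ be the universal unital $C^*$-algebra generated by $x_{ij}$, $i,j\in[N]$, subject to $R^{Sp}_p(x)$ for all $p\in\Pi$. A compact matrix quantum group $G$ (of size $N$) is a unital $C^*$-algebra $C(G)$ generated by the entries of an $N\times N$ matrix $u=(u_{ij})$ such that $u$ and $\bar u=(u_{ij}^*)$ are invertible and there is a $*$-homomorphism $\Delta:C(G)\to C(G)\otimes C(G)$ with $\Delta(u_{ij})=\sum_k u_{ik}\otimes u_{kj}$ (minimal tensor product). Write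 $G'\subseteq G$ if there is a $*$-homomorphism $C(G)\to C(G')$ mapping $u_{ij}$ to the corresponding generator $u'_{ij}$; two such quantum groups are identified if there is a $*$-isomorphism with this property. $G$ is the quantum symmetry group of $X_{N,N}(\Pi)$ if there are unital $*$-homomorphisms $\alpha,\beta:C(X_{N,N}(\Pi))\to C(G)\otimes C(X_{N,N}(\Pi))$ with $\alpha(x_{ij})=\sum_k u_{ik}\otimes x_{kj}$ and $\beta(x_{ij})=\sum_k u_{ki}\otimes x_{kj}$, and every compact matrix quantum group $G'$ of size $N$ that admits such maps satisfies $G'\subseteq G$. Claim: if $\Pi$ and $\Pi'$ are sets of two-coloured partitions containing the four mixed-coloured pair partitions and $\langle\Pi\rangle=\langle\Pi'\rangle$, then $X_{N,N}(\Pi)$ has a quantum symmetry group, a compact matrix quantum group is the quantum symmetry group of $X_{N,N}(\Pi)$ if and only if it is the quantum symmetry group of $X_{N,N}(\Pi')$, and the quantum symmetry groups of $X_{N,N}(\Pi)$ and $X_{N,N}(\Pi')$ coincide up to the identification above. -/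

import Mathlib

open scoped TensorProduct ComplexOrder

universe u v

noncomputable section

/-- A C⋆-seminorm on a unital complex ⋆-algebra. -/
structure CStarSeminorm (A : Type u) [Ring A] [StarRing A] [Algebra ℂ A] where
  toFun : A → ℝ
  map_zero : toFun 0 = 0
  add_le : ∀ a b, toFun (a + b) ≤ toFun a + toFun b
  map_smul : ∀ (c : ℂ) a, toFun (c • a) = ‖c‖ * toFun a
  mul_le : ∀ a b, toFun (a * b) ≤ toFun a * toFun b
  map_star_mul_self : ∀ a, toFun (star a * a) = toFun a ^ 2

namespace CStarSeminorm

section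

variable {A : Type u} [Ring A] [StarRing A] [Algebra ℂ A]

lemma map_neg (q : CStarSeminorm A) (a : A) : q.toFun (-a) = q.toFun a := by
  simpa using q.map_smul (-1) a

lemma nonneg (q : CStarSeminorm A) (a : A) : 0 ≤ q.toFun a := by
  have h := q.add_le a (-a)
  rw [add_neg_cancel, q.map_zero, q.map_neg] at h
  linarith

lemma le_star (q : CStarSeminorm A) (a : A) : q.toFun a ≤ q.toFun (star a) := by
  have h := q.mul_le (star a) a
  rw [q.map_star_mul_self, sq] at h
  rcases (q.nonneg a).eq_or_lt with h0 | h0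
  · rw [← h0]; exact q.nonneg _
  · exact le_of_mul_le_mul_right h h0

lemma map_star (q : CStarSeminorm A) (a : A) : q.toFun (star a) = q.toFun a :=
  le_antisymm (by simpa using q.le_star (star a)) (q.le_star a)

/-- The C⋆-seminorm `a ↦ ‖π a‖` of a unital ⋆-homomorphism into a C⋆-algebra. -/
def ofStarAlgHom {B : Type v} [CStarAlgebra B] (π : A →⋆ₐ[ℂ] B) : CStarSeminorm A where
  toFun a := ‖π a‖
  map_zero := by simp
  add_le a b := by rw [map_add]; exact norm_add_le _ _
  map_smul c a := by rw [_root_.map_smul, norm_smul]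
  mul_le a b := by rw [map_mul]; exact norm_mul_le _ _
  map_star_mul_self a := by
    rw [map_mul, StarHomClass.map_star, CStarRing.norm_star_mul_self, sq]

/-- The pointwise supremum of a pointwise bounded set of C⋆-seminorms. -/
def sup (S : Set (CStarSeminorm A)) (hS : ∀ a, ∃ C, ∀ q ∈ S, q.toFun a ≤ C) :
    CStarSeminorm A where
  toFun a := ⨆ q : S, q.1.toFun a
  map_zero := by simp [CStarSeminorm.map_zero]
  add_le a b := by
    have hb : ∀ a, BddAbove (Set.range fun q : S => q.1.toFun a) := fun a => by
      obtain ⟨C, hC⟩ := hS a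
      exact ⟨C, by rintro _ ⟨q, rfl⟩; exact hC q.1 q.2⟩
    refine Real.iSup_le (fun q => (q.1.add_le a b).trans ?_) ?_
    · exact add_le_add (le_ciSup (hb a) q) (le_ciSup (hb b) q)
    · exact add_nonneg (Real.iSup_nonneg fun q => q.1.nonneg a)
        (Real.iSup_nonneg fun q => q.1.nonneg b)
  map_smul c a := by
    simp_rw [CStarSeminorm.map_smul]
    exact (Real.mul_iSup_of_nonneg (norm_nonneg c) _).symm
  mul_le a b := by
    have hb : ∀ a, BddAbove (Set.range fun q : S => q.1.toFun a) := fun a => by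
      obtain ⟨C, hC⟩ := hS a
      exact ⟨C, by rintro _ ⟨q, rfl⟩; exact hC q.1 q.2⟩
    have h0 : ∀ a, 0 ≤ ⨆ q : S, q.1.toFun a := fun a => Real.iSup_nonneg fun q => q.1.nonneg a
    refine Real.iSup_le (fun q => (q.1.mul_le a b).trans ?_) (mul_nonneg (h0 a) (h0 b))
    exact mul_le_mul (le_ciSup (hb a) q) (le_ciSup (hb b) q) (q.1.nonneg b) (h0 a)
  map_star_mul_self a := by
    have hb : ∀ a, BddAbove (Set.range fun q : S => q.1.toFun a) := fun a => by
      obtain ⟨C, hC⟩ := hS a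
      exact ⟨C, by rintro _ ⟨q, rfl⟩; exact hC q.1 q.2⟩
    have h0 : ∀ a, 0 ≤ ⨆ q : S, q.1.toFun a := fun a => Real.iSup_nonneg fun q => q.1.nonneg a
    apply le_antisymm
    · refine Real.iSup_le (fun q => ?_) (sq_nonneg _)
      rw [q.1.map_star_mul_self]
      exact pow_le_pow_left₀ (q.1.nonneg a) (le_ciSup (hb a) q) 2
    · apply Real.le_sqrt (h0 a) (h0 _) |>.1
      refine Real.iSup_le (fun q => ?_) (Real.sqrt_nonneg _)
      apply Real.le_sqrt (q.1.nonneg a) (h0 _) |>.2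
      rw [← q.1.map_star_mul_self]
      exact le_ciSup (hb (star a * a)) q

/-- The ⋆-algebra `A` equipped with the C⋆-seminorm `q`. -/
def Pre (_q : CStarSeminorm A) : Type u := A

variable (q : CStarSeminorm A)

instance : Ring q.Pre := inferInstanceAs (Ring A)
instance : StarRing q.Pre := inferInstanceAs (StarRing A)
instance : Algebra ℂ q.Pre := inferInstanceAs (Algebra ℂ A)

/-- The seminorm `q` as a group seminorm. -/
def toAddGroupSeminorm : AddGroupSeminorm q.Pre where
  toFun := q.toFun
  map_zero' := q.map_zero
  add_le' := q.add_le
  neg' := q.map_neg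

instance : SeminormedRing q.Pre where
  __ := q.toAddGroupSeminorm.toSeminormedAddCommGroup
  __ := (inferInstance : Ring q.Pre)
  norm_mul_le := q.mul_le

lemma pre_norm_def (a : q.Pre) : ‖a‖ = q.toFun a := rfl

instance : NormedAlgebra ℂ q.Pre where
  norm_smul_le c a := (q.map_smul c a).le

instance [StarModule ℂ A] : StarModule ℂ q.Pre := inferInstanceAs (StarModule ℂ A)

instance : NormedStarGroup q.Pre where
  norm_star_le a := (q.map_star a).le

/-- The separated completion of `A` with respect to the C⋆-seminorm `q`. -/
abbrev Completion : Type u := UniformSpace.Completion q.Pre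

lemma uniformContinuous_star_pre : UniformContinuous (star : q.Pre → q.Pre) :=
  (AddMonoidHomClass.isometry_of_norm (starAddEquiv : q.Pre ≃+ q.Pre) q.map_star).uniformContinuous

instance : Star q.Completion := ⟨UniformSpace.Completion.map star⟩

instance : ContinuousStar q.Completion := ⟨UniformSpace.Completion.continuous_map⟩

lemma star_coe (a : q.Pre) : star (a : q.Completion) = ((star a : q.Pre) : q.Completion) :=
  UniformSpace.Completion.map_coe q.uniformContinuous_star_pre a

instance : StarRing q.Completion where
  star_involutive x := by
    induction x using UniformSpace.Completion.induction_on with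
    | hp => exact isClosed_eq (by fun_prop) (by fun_prop)
    | ih a => rw [star_coe, star_coe, star_star]
  star_mul x y := by
    induction x, y using UniformSpace.Completion.induction_on₂ with
    | hp => exact isClosed_eq (by fun_prop) (by fun_prop)
    | ih a b =>
      rw [star_coe, star_coe, ← UniformSpace.Completion.coe_mul, star_coe, star_mul,
        UniformSpace.Completion.coe_mul]
  star_add x y := by
    induction x, y using UniformSpace.Completion.induction_on₂ with
    | hp => exact isClosed_eq (by fun_prop) (by fun_prop)
    | ih a b =>
      rw [star_coe, star_coe, ← UniformSpace.Completion.coe_add, star_coe, star_add,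
        UniformSpace.Completion.coe_add]

instance : NormedAlgebra ℂ q.Completion where
  norm_smul_le := norm_smul_le

instance [StarModule ℂ A] : StarModule ℂ q.Completion where
  star_smul c x := by
    induction x using UniformSpace.Completion.induction_on with
    | hp =>
      exact isClosed_eq (continuous_id.const_smul c).star (continuous_star.const_smul (star c))
    | ih a =>
      rw [star_coe, ← UniformSpace.Completion.coe_smul, star_coe, star_smul,
        UniformSpace.Completion.coe_smul]

instance : CStarRing q.Completion where
  norm_mul_self_le x := by
    induction x using UniformSpace.Completion.induction_on with
    | hp => exact isClosed_le (by fun_prop) (by fun_prop)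
    | ih a =>
      rw [star_coe, ← UniformSpace.Completion.coe_mul, UniformSpace.Completion.norm_coe,
        UniformSpace.Completion.norm_coe, pre_norm_def, pre_norm_def, ← sq]
      exact (q.map_star_mul_self a).ge

instance [StarModule ℂ A] : CStarAlgebra q.Completion where

/-- The canonical map from `A` into its completion. -/
def toCompletion [StarModule ℂ A] : A →⋆ₐ[ℂ] q.Completion where
  toFun a := ((show q.Pre from a : q.Pre) : q.Completion)
  map_one' := UniformSpace.Completion.coe_one q.Pre
  map_mul' a b := UniformSpace.Completion.coe_mul (α := q.Pre) a b
  map_zero' := UniformSpace.Completion.coe_zero (α := q.Pre)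
  map_add' a b := UniformSpace.Completion.coe_add (α := q.Pre) a b
  commutes' _ := rfl
  map_star' a := (q.star_coe a).symm

end

end CStarSeminorm

/-! ### The free ⋆-algebra -/

/-- The two colours of points: white corresponds to the exponent `1`, black to `*`. -/
inductive Colour
  | white
  | black

/-- The opposite colour. -/
def Colour.flip : Colour → Colour
  | white => black
  | black => white

/-- `a ^ ω` for a colour `ω`, i.e. `a` if `ω` is white and `star a` if `ω` is black. -/
def Colour.pow {A : Type u} [Star A] (a : A) : Colour → A
  | white => a
  | black => star a

/-- The free unital complex ⋆-algebra on a set `X` of generators: noncommutative polynomials in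
the letters `(x, white)`, standing for `x`, and `(x, black)`, standing for `star x`. -/
def FreeStarAlgebra (X : Type u) : Type u := FreeAlgebra ℂ (X × Colour)

namespace FreeStarAlgebra

variable {X : Type u}

instance : Ring (FreeStarAlgebra X) := inferInstanceAs (Ring (FreeAlgebra ℂ (X × Colour)))
instance : Algebra ℂ (FreeStarAlgebra X) :=
  inferInstanceAs (Algebra ℂ (FreeAlgebra ℂ (X × Colour)))

/-- The letter `(x, c)`. -/
def letter (x : X) (c : Colour) : FreeStarAlgebra X := FreeAlgebra.ι ℂ (x, c)

/-- The generator `x`. -/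
def of (x : X) : FreeStarAlgebra X := letter x .white

@[elab_as_elim]
lemma induction {C : FreeStarAlgebra X → Prop}
    (algebraMap : ∀ r, C (algebraMap ℂ (FreeStarAlgebra X) r)) (letter : ∀ x c, C (letter x c))
    (mul : ∀ a b, C a → C b → C (a * b)) (add : ∀ a b, C a → C b → C (a + b))
    (a : FreeStarAlgebra X) : C a :=
  FreeAlgebra.induction ℂ (X × Colour) algebraMap (fun x => letter x.1 x.2) mul add a

/-- The opposite algebra with conjugated scalars. -/
abbrev conjOpAlgebra : Algebra ℂ (FreeStarAlgebra X)ᵐᵒᵖ :=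
  ((algebraMap ℂ (FreeStarAlgebra X)ᵐᵒᵖ).comp (starRingEnd ℂ)).toAlgebra'
    fun c x => Algebra.commutes (starRingEnd ℂ c) x

/-- The involution as a ring homomorphism into the opposite ring: it reverses words, exchanges
the two letters of each generator and conjugates the coefficients. -/
def starHom : FreeStarAlgebra X →+* (FreeStarAlgebra X)ᵐᵒᵖ :=
  RingHomClass.toRingHom (@FreeAlgebra.lift ℂ (X × Colour) _ (FreeStarAlgebra X)ᵐᵒᵖ _ conjOpAlgebra
    fun x => MulOpposite.op (letter x.1 x.2.flip))

lemma starHom_algebraMap (c : ℂ) : starHom (algebraMap ℂ (FreeStarAlgebra X) c) =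
    MulOpposite.op (algebraMap ℂ (FreeStarAlgebra X) (starRingEnd ℂ c)) :=
  @AlgHom.commutes ℂ (FreeAlgebra ℂ (X × Colour)) (FreeStarAlgebra X)ᵐᵒᵖ _ _ _ _ conjOpAlgebra _ c

lemma starHom_letter (x : X) (c : Colour) :
    starHom (letter x c) = MulOpposite.op (letter x c.flip) :=
  @FreeAlgebra.lift_ι_apply ℂ (X × Colour) _ (FreeStarAlgebra X)ᵐᵒᵖ _ conjOpAlgebra _ (x, c)

instance : StarRing (FreeStarAlgebra X) where
  star a := (starHom a).unop
  star_involutive a := by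
    induction a using induction with
    | algebraMap r => simp [starHom_algebraMap]
    | letter x c => cases c <;> simp [starHom_letter, Colour.flip]
    | mul a b ha hb => simp [ha, hb]
    | add a b ha hb => simp [ha, hb]
  star_mul a b := by simp
  star_add a b := by simp

lemma star_def (a : FreeStarAlgebra X) : star a = (starHom a).unop := rfl

instance : StarModule ℂ (FreeStarAlgebra X) where
  star_smul c a := by
    rw [Algebra.smul_def, star_mul, Algebra.smul_def, star_def (algebraMap _ _ c),
      starHom_algebraMap, MulOpposite.unop_op, ← Algebra.commutes]
    rfl

/-- Evaluation of a noncommutative ⋆-polynomial at a family in a ⋆-algebra. -/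
def eval {B : Type v} [Ring B] [StarRing B] [Algebra ℂ B] [StarModule ℂ B] (y : X → B) :
    FreeStarAlgebra X →⋆ₐ[ℂ] B :=
  let f : FreeStarAlgebra X →ₐ[ℂ] B := FreeAlgebra.lift ℂ fun x : X × Colour => x.2.pow (y x.1)
  { f with
    map_star' := fun a => by
      have hl : ∀ x c, f (letter x c) = c.pow (y x) := fun x c => FreeAlgebra.lift_ι_apply _ _
      change f (star a) = star (f a)
      induction a using induction with
      | algebraMap r =>
        rw [star_def, starHom_algebraMap, MulOpposite.unop_op, f.commutes, f.commutes,
          ← algebraMap_star_comm]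
        rfl
      | letter x c =>
        rw [star_def, starHom_letter, MulOpposite.unop_op, hl, hl]
        cases c <;> simp [Colour.flip, Colour.pow]
      | mul a b ha hb => rw [star_mul, map_mul, map_mul, star_mul, ha, hb]
      | add a b ha hb => rw [star_add, map_add, map_add, star_add, ha, hb] }

lemma eval_letter {B : Type v} [Ring B] [StarRing B] [Algebra ℂ B] [StarModule ℂ B] (y : X → B)
    (x : X) (c : Colour) : eval y (letter x c) = c.pow (y x) :=
  FreeAlgebra.lift_ι_apply _ _

end FreeStarAlgebra

/-! ### Universal C⋆-algebras -/

/-- A family of relations on a set `X` of generators, i.e. a property of families `X → B` in unital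
C⋆-algebras `B`, such that the norm of every generator is uniformly bounded over all families
satisfying the relations. The last condition is the usual one for the existence of the universal
C⋆-algebra. -/
structure CStarRelations (X : Type u) where
  Holds : ∀ (B : Type u) [CStarAlgebra B], (X → B) → Prop
  bounded : ∀ x, ∃ C : ℝ, ∀ (B : Type u) [CStarAlgebra B] (y : X → B), Holds B y → ‖y x‖ ≤ C

namespace CStarRelations

variable {X : Type u} (R : CStarRelations X)

lemma eval_bounded (a : FreeStarAlgebra X) : ∃ C : ℝ, ∀ (B : Type u) [CStarAlgebra B] (y : X → B),
    R.Holds B y → ‖FreeStarAlgebra.eval y a‖ ≤ C := by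
  induction a using FreeStarAlgebra.induction with
  | algebraMap r =>
    refine ⟨‖r‖, fun B _ y _ => ?_⟩
    rw [AlgHomClass.commutes, Algebra.algebraMap_eq_smul_one, norm_smul]
    rcases subsingleton_or_nontrivial B with h | h
    · rw [Subsingleton.elim (1 : B) 0]; simp
    · simp
  | letter x c =>
    obtain ⟨C, hC⟩ := R.bounded x
    refine ⟨C, fun B _ y hy => ?_⟩
    rw [FreeStarAlgebra.eval_letter]
    cases c
    · exact hC B y hy
    · simpa [Colour.pow] using hC B y hy
  | mul a b ha hb =>
    obtain ⟨C, hC⟩ := ha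
    obtain ⟨D, hD⟩ := hb
    refine ⟨C * D, fun B _ y hy => ?_⟩
    rw [map_mul]
    exact (norm_mul_le _ _).trans (mul_le_mul (hC B y hy) (hD B y hy) (norm_nonneg _)
      ((norm_nonneg _).trans (hC B y hy)))
  | add a b ha hb =>
    obtain ⟨C, hC⟩ := ha
    obtain ⟨D, hD⟩ := hb
    refine ⟨C + D, fun B _ y hy => ?_⟩
    rw [map_add]
    exact (norm_add_le _ _).trans (add_le_add (hC B y hy) (hD B y hy))

/-- The seminorm `‖a‖ = sup ‖a(y)‖` on noncommutative ⋆-polynomials `a`, where `y` ranges over all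
families in unital C⋆-algebras satisfying the relations. -/
def universalSeminorm : CStarSeminorm (FreeStarAlgebra X) :=
  CStarSeminorm.sup
    {q | ∃ (B : Type u) (_ : CStarAlgebra B) (y : X → B), R.Holds B y ∧
      q = CStarSeminorm.ofStarAlgHom (FreeStarAlgebra.eval y)}
    (fun a => by
      obtain ⟨C, hC⟩ := R.eval_bounded a
      refine ⟨C, ?_⟩
      rintro _ ⟨B, _, y, hy, rfl⟩
      exact hC B y hy)

/-- The universal unital C⋆-algebra `C*(x ∈ X | R)`. -/
abbrev Universal : Type u := R.universalSeminorm.Completion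

/-- The canonical generators of the universal C⋆-algebra. -/
def gen (x : X) : R.Universal := R.universalSeminorm.toCompletion (FreeStarAlgebra.of x)

end CStarRelations

/-! ### The minimal tensor product -/

/-- The Hilbert space tensor product: the completion of the algebraic tensor product with respect
to the inner product `⟪x ⊗ y, x' ⊗ y'⟫ = ⟪x, x'⟫ * ⟪y, y'⟫`. -/
def HilbertTensor (H K : Type u) [NormedAddCommGroup H] [InnerProductSpace ℂ H]
    [NormedAddCommGroup K] [InnerProductSpace ℂ K] : Type u :=
  UniformSpace.Completion (H ⊗[ℂ] K)

section MinTensor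

variable {H K : Type u} [NormedAddCommGroup H] [InnerProductSpace ℂ H]
  [NormedAddCommGroup K] [InnerProductSpace ℂ K]

instance : NormedAddCommGroup (HilbertTensor H K) :=
  inferInstanceAs (NormedAddCommGroup (UniformSpace.Completion (H ⊗[ℂ] K)))
instance : InnerProductSpace ℂ (HilbertTensor H K) :=
  inferInstanceAs (InnerProductSpace ℂ (UniformSpace.Completion (H ⊗[ℂ] K)))
instance : CompleteSpace (HilbertTensor H K) :=
  inferInstanceAs (CompleteSpace (UniformSpace.Completion (H ⊗[ℂ] K)))

/-- The isometric embedding of the algebraic tensor product. -/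
def HilbertTensor.of : (H ⊗[ℂ] K) →ₗᵢ[ℂ] HilbertTensor H K :=
  (UniformSpace.Completion.toComplₗᵢ : (H ⊗[ℂ] K) →ₗᵢ[ℂ] UniformSpace.Completion (H ⊗[ℂ] K))

@[elab_as_elim]
lemma HilbertTensor.induction {p : HilbertTensor H K → Prop} (z : HilbertTensor H K)
    (closed : IsClosed {z | p z}) (of : ∀ z, p (HilbertTensor.of z)) : p z :=
  UniformSpace.Completion.induction_on (α := H ⊗[ℂ] K) z closed of

/-- The operator `S ⊗ T` on the Hilbert space tensor product `H ⊗ K`. -/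
def opTensor (S : H →L[ℂ] H) (T : K →L[ℂ] K) : HilbertTensor H K →L[ℂ] HilbertTensor H K :=
  ((TensorProduct.mapL S T).completion :
    UniformSpace.Completion (H ⊗[ℂ] K) →L[ℂ] UniformSpace.Completion (H ⊗[ℂ] K))

lemma opTensor_of (S : H →L[ℂ] H) (T : K →L[ℂ] K) (z : H ⊗[ℂ] K) :
    opTensor S T (HilbertTensor.of z) = HilbertTensor.of (TensorProduct.mapL S T z) :=
  ContinuousLinearMap.completion_apply_coe _ _

lemma hilbertTensor_ext {f g : HilbertTensor H K →L[ℂ] HilbertTensor H K}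
    (h : ∀ z : H ⊗[ℂ] K, f (HilbertTensor.of z) = g (HilbertTensor.of z)) : f = g := by
  ext z
  induction z using HilbertTensor.induction with
  | closed => exact isClosed_eq f.continuous g.continuous
  | of z => exact h z

lemma opTensor_mul (S S' : H →L[ℂ] H) (T T' : K →L[ℂ] K) :
    opTensor (S * S') (T * T') = opTensor S T * opTensor S' T' :=
  hilbertTensor_ext fun z => by
    rw [mul_apply_eq_comp, opTensor_of, opTensor_of, opTensor_of,
      TensorProduct.mapL_mul, mul_apply_eq_comp]

lemma opTensor_one : opTensor (1 : H →L[ℂ] H) (1 : K →L[ℂ] K) = 1 :=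
  hilbertTensor_ext fun z => by
    rw [opTensor_of]
    exact congrArg _ (congrArg (fun f : (H ⊗[ℂ] K) →L[ℂ] (H ⊗[ℂ] K) => f z)
      TensorProduct.mapL_id_id)

lemma opTensor_add_left (S S' : H →L[ℂ] H) (T : K →L[ℂ] K) :
    opTensor (S + S') T = opTensor S T + opTensor S' T :=
  hilbertTensor_ext fun z => by
    rw [add_apply, opTensor_of, opTensor_of, opTensor_of,
      TensorProduct.mapL_add_left, add_apply, map_add]

lemma opTensor_add_right (S : H →L[ℂ] H) (T T' : K →L[ℂ] K) :
    opTensor S (T + T') = opTensor S T + opTensor S T' :=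
  hilbertTensor_ext fun z => by
    rw [add_apply, opTensor_of, opTensor_of, opTensor_of,
      TensorProduct.mapL_add_right, add_apply, map_add]

lemma opTensor_smul_left (c : ℂ) (S : H →L[ℂ] H) (T : K →L[ℂ] K) :
    opTensor (c • S) T = c • opTensor S T :=
  hilbertTensor_ext fun z => by
    rw [smul_apply, opTensor_of, opTensor_of,
      TensorProduct.mapL_smul_left, smul_apply,
      map_smul]

lemma opTensor_smul_right (c : ℂ) (S : H →L[ℂ] H) (T : K →L[ℂ] K) :
    opTensor S (c • T) = c • opTensor S T :=
  hilbertTensor_ext fun z => by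
    rw [smul_apply, opTensor_of, opTensor_of,
      TensorProduct.mapL_smul_right, smul_apply,
      map_smul]

lemma norm_opTensor_le (S : H →L[ℂ] H) (T : K →L[ℂ] K) : ‖opTensor S T‖ ≤ ‖S‖ * ‖T‖ := by
  refine ContinuousLinearMap.opNorm_le_bound _ (by positivity) fun z => ?_
  induction z using HilbertTensor.induction with
  | closed => exact isClosed_le (by fun_prop) (by fun_prop)
  | of z =>
    rw [opTensor_of, LinearIsometry.norm_map, LinearIsometry.norm_map]
    exact (ContinuousLinearMap.le_opNorm _ _).trans
      (mul_le_mul_of_nonneg_right (TensorProduct.norm_mapL_le S T) (norm_nonneg _))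

variable [CompleteSpace H] [CompleteSpace K]

lemma opTensor_star (S : H →L[ℂ] H) (T : K →L[ℂ] K) :
    opTensor (star S) (star T) = star (opTensor S T) := by
  refine (ContinuousLinearMap.eq_adjoint_iff _ _).mpr fun x y => ?_
  induction x using HilbertTensor.induction with
  | closed => exact isClosed_eq (by fun_prop) (by fun_prop)
  | of x =>
  induction y using HilbertTensor.induction with
  | closed => exact isClosed_eq (by fun_prop) (by fun_prop)
  | of y =>
    rw [opTensor_of, opTensor_of, LinearIsometry.inner_map_map, LinearIsometry.inner_map_map]
    induction x using TensorProduct.induction_on with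
    | zero => simp
    | add x x' hx hx' => rw [map_add, inner_add_left, inner_add_left, hx, hx']
    | tmul x x' =>
      induction y using TensorProduct.induction_on with
      | zero => simp
      | add y y' hy hy' => rw [map_add, inner_add_right, inner_add_right, hy, hy']
      | tmul y y' =>
        simp [ContinuousLinearMap.star_eq_adjoint, ContinuousLinearMap.adjoint_inner_left]

variable {A B : Type u} [CStarAlgebra A] [CStarAlgebra B]

/-- The tensor product `π ⊗ ρ` of two representations on Hilbert spaces, as a representation of the
algebraic tensor product on the Hilbert space tensor product. -/
def tensorRep (π : A →⋆ₐ[ℂ] (H →L[ℂ] H)) (ρ : B →⋆ₐ[ℂ] (K →L[ℂ] K)) :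
    A ⊗[ℂ] B →⋆ₐ[ℂ] (HilbertTensor H K →L[ℂ] HilbertTensor H K) :=
  let f : A →ₐ[ℂ] (HilbertTensor H K →L[ℂ] HilbertTensor H K) :=
    AlgHom.ofLinearMap
      { toFun := fun a => opTensor (π a) 1
        map_add' := fun a a' => by rw [map_add, opTensor_add_left]
        map_smul' := fun c a => by rw [map_smul, opTensor_smul_left, RingHom.id_apply] }
      (by simp [opTensor_one])
      (fun a a' => by
        change opTensor (π (a * a')) 1 = opTensor (π a) 1 * opTensor (π a') 1
        rw [← opTensor_mul, map_mul, mul_one])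
  let g : B →ₐ[ℂ] (HilbertTensor H K →L[ℂ] HilbertTensor H K) :=
    AlgHom.ofLinearMap
      { toFun := fun b => opTensor 1 (ρ b)
        map_add' := fun b b' => by rw [map_add, opTensor_add_right]
        map_smul' := fun c b => by rw [map_smul, opTensor_smul_right, RingHom.id_apply] }
      (by simp [opTensor_one])
      (fun b b' => by
        change opTensor 1 (ρ (b * b')) = opTensor 1 (ρ b) * opTensor 1 (ρ b')
        rw [← opTensor_mul, map_mul, mul_one])
  let h : A ⊗[ℂ] B →ₐ[ℂ] (HilbertTensor H K →L[ℂ] HilbertTensor H K) :=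
    Algebra.TensorProduct.lift f g fun a b => by
      change opTensor (π a) 1 * opTensor 1 (ρ b) = opTensor 1 (ρ b) * opTensor (π a) 1
      rw [← opTensor_mul, ← opTensor_mul, mul_one, one_mul, mul_one, one_mul]
  { h with
    map_star' := fun t => by
      have ht : ∀ a b, h (a ⊗ₜ[ℂ] b) = opTensor (π a) (ρ b) := fun a b => by
        rw [Algebra.TensorProduct.lift_tmul]
        change opTensor (π a) 1 * opTensor 1 (ρ b) = _
        rw [← opTensor_mul, mul_one, one_mul]
      change h (star t) = star (h t)
      induction t using TensorProduct.induction_on with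
      | zero => simp
      | add t t' h1 h2 => rw [star_add, map_add, map_add, star_add, h1, h2]
      | tmul a b =>
        rw [TensorProduct.star_tmul, ht, ht, ← opTensor_star, map_star, map_star] }

lemma tensorRep_tmul (π : A →⋆ₐ[ℂ] (H →L[ℂ] H)) (ρ : B →⋆ₐ[ℂ] (K →L[ℂ] K)) (a : A) (b : B) :
    tensorRep π ρ (a ⊗ₜ[ℂ] b) = opTensor (π a) (ρ b) := by
  change opTensor (π a) 1 * opTensor 1 (ρ b) = _
  rw [← opTensor_mul, mul_one, one_mul]

end MinTensor

section MinTensor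

variable (A B : Type u) [CStarAlgebra A] [CStarAlgebra B]

/-- The minimal (spatial) C⋆-norm on the algebraic tensor product of two C⋆-algebras:
`‖t‖ = sup ‖(π ⊗ ρ) t‖` over all pairs of representations on Hilbert spaces. -/
def minSeminorm : CStarSeminorm (A ⊗[ℂ] B) :=
  CStarSeminorm.sup
    {q | ∃ (H K : Type u) (_ : NormedAddCommGroup H) (_ : InnerProductSpace ℂ H)
      (_ : CompleteSpace H) (_ : NormedAddCommGroup K) (_ : InnerProductSpace ℂ K)
      (_ : CompleteSpace K) (π : A →⋆ₐ[ℂ] (H →L[ℂ] H)) (ρ : B →⋆ₐ[ℂ] (K →L[ℂ] K)),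
      q = CStarSeminorm.ofStarAlgHom (tensorRep π ρ)}
    (fun t => by
      induction t using TensorProduct.induction_on with
      | zero =>
        refine ⟨0, ?_⟩
        rintro _ ⟨H, K, _, _, _, _, _, _, π, ρ, rfl⟩
        exact (CStarSeminorm.map_zero _).le
      | add t t' ht ht' =>
        obtain ⟨C, hC⟩ := ht
        obtain ⟨D, hD⟩ := ht'
        exact ⟨C + D, fun q hq => (q.add_le t t').trans (add_le_add (hC q hq) (hD q hq))⟩
      | tmul a b =>
        refine ⟨‖a‖ * ‖b‖, ?_⟩
        rintro _ ⟨H, K, _, _, _, _, _, _, π, ρ, rfl⟩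
        change ‖tensorRep π ρ (a ⊗ₜ[ℂ] b)‖ ≤ _
        rw [tensorRep_tmul]
        exact (norm_opTensor_le _ _).trans (mul_le_mul (NonUnitalStarAlgHom.norm_apply_le π a)
          (NonUnitalStarAlgHom.norm_apply_le ρ b) (norm_nonneg _) (norm_nonneg _)))

/-- The minimal tensor product of two C⋆-algebras. -/
abbrev MinTensor : Type u := (minSeminorm A B).Completion

variable {A B}

/-- The elementary tensor `a ⊗ b` in the minimal tensor product. -/
def minTmul (a : A) (b : B) : MinTensor A B := (minSeminorm A B).toCompletion (a ⊗ₜ[ℂ] b)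

end MinTensor

/-! ### Two-coloured partitions -/

/-- A two-coloured partition with `k` upper and `l` lower points. The blocks are the classes of an
equivalence relation on the points. -/
structure TwoColouredPartition where
  k : ℕ
  l : ℕ
  upper : Fin k → Colour
  lower : Fin l → Colour
  blocks : Setoid (Fin k ⊕ Fin l)

namespace TwoColouredPartition

/-- The partition with a single block (or no block, if there are no points). -/
def oneBlock {k l : ℕ} (ω : Fin k → Colour) (ω' : Fin l → Colour) : TwoColouredPartition :=
  ⟨k, l, ω, ω', ⊤⟩

/-- The identity partition on one point of colour `c`. -/
def idPartition (c : Colour) : TwoColouredPartition := oneBlock ![c] ![c]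

/-- The pair partition on two lower points with colours `c`, `c'`. -/
def lowerPair (c c' : Colour) : TwoColouredPartition := oneBlock ![] ![c, c']

/-- The pair partition on two upper points with colours `c`, `c'`. -/
def upperPair (c c' : Colour) : TwoColouredPartition := oneBlock ![c, c'] ![]

/-- The four mixed-coloured pair partitions. -/
def mixedPairs : Set TwoColouredPartition :=
  {lowerPair .white .black, lowerPair .black .white, upperPair .white .black,
    upperPair .black .white}

/-- The tensor product: horizontal concatenation. -/
def tensor (p q : TwoColouredPartition) : TwoColouredPartition where
  k := p.k + q.k
  l := p.l + q.l
  upper := Fin.append p.upper q.upper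
  lower := Fin.append p.lower q.lower
  blocks := Setoid.comap
    (fun x : Fin (p.k + q.k) ⊕ Fin (p.l + q.l) =>
      Equiv.sumSumSumComm (Fin p.k) (Fin q.k) (Fin p.l) (Fin q.l)
        (Sum.map finSumFinEquiv.symm finSumFinEquiv.symm x))
    { r := Sum.LiftRel p.blocks.r q.blocks.r
      iseqv :=
        { refl := by rintro (a | a) <;> constructor <;> first | exact p.blocks.refl' _ | exact q.blocks.refl' _
          symm := by rintro _ _ (h | h) <;> constructor <;> first | exact p.blocks.symm' h | exact q.blocks.symm' h
          trans := by
            rintro _ _ _ (h | h) (h' | h') <;> constructor <;>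
              first | exact p.blocks.trans' h h' | exact q.blocks.trans' h h' } }

/-- The involution: reflection at the horizontal axis. -/
def involution (p : TwoColouredPartition) : TwoColouredPartition where
  k := p.l
  l := p.k
  upper := p.lower
  lower := p.upper
  blocks := Setoid.comap Sum.swap p.blocks

/-- Two points are linked in the vertical concatenation of `r` (above) and `s` (below) if they are
points of the same block of `r` or of the same block of `s`. -/
inductive Linked {k l m : ℕ} (r : Setoid (Fin k ⊕ Fin l)) (s : Setoid (Fin l ⊕ Fin m)) :
    Fin k ⊕ (Fin l ⊕ Fin m) → Fin k ⊕ (Fin l ⊕ Fin m) → Prop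
  | above {x y : Fin k ⊕ Fin l} (h : r x y) :
      Linked r s (Sum.map id Sum.inl x) (Sum.map id Sum.inl y)
  | below {x y : Fin l ⊕ Fin m} (h : s x y) : Linked r s (Sum.inr x) (Sum.inr y)

/-- The blocks of the composition: vertical concatenation of `r` (above) and `s` (below), after
which the `l` middle points are removed. -/
def compBlocks {k l m : ℕ} (r : Setoid (Fin k ⊕ Fin l)) (s : Setoid (Fin l ⊕ Fin m)) :
    Setoid (Fin k ⊕ Fin m) :=
  Setoid.comap (Sum.map id Sum.inr) (Relation.EqvGen.setoid (Linked r s))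

/-- A category of partitions: a set of partitions that contains the identity partitions and the
mixed-coloured pair partitions and is closed under tensor products, involution and composition
(of partitions with matching colours). -/
structure IsCategory (C : Set TwoColouredPartition) : Prop where
  id_mem : ∀ c, idPartition c ∈ C
  mixedPairs_subset : mixedPairs ⊆ C
  tensor_mem : ∀ p ∈ C, ∀ q ∈ C, tensor p q ∈ C
  involution_mem : ∀ p ∈ C, involution p ∈ C
  comp_mem : ∀ {k l m : ℕ} (ω : Fin k → Colour) (ω' : Fin l → Colour) (ω'' : Fin m → Colour)
    (r : Setoid (Fin k ⊕ Fin l)) (s : Setoid (Fin l ⊕ Fin m)),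
    ⟨k, l, ω, ω', r⟩ ∈ C → ⟨l, m, ω', ω'', s⟩ ∈ C → ⟨k, m, ω, ω'', compBlocks r s⟩ ∈ C

/-- The category of partitions `⟨P⟩` generated by a set `P` of partitions. -/
def generatedCategory (P : Set TwoColouredPartition) : Set TwoColouredPartition :=
  ⋂₀ {C | IsCategory C ∧ P ⊆ C}

/-! ### Labelings -/

variable (p : TwoColouredPartition)

/-- The through-blocks: blocks containing both upper and lower points. -/
def ThroughBlock : Type :=
  {b : Quotient p.blocks // (∃ a, Quotient.mk p.blocks (Sum.inl a) = b) ∧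
    ∃ a, Quotient.mk p.blocks (Sum.inr a) = b}

/-- Valid labelings of the upper row: connected upper points have equal labels. -/
def ValidUpper {N : ℕ} (t : Fin p.k → Fin N) : Prop :=
  ∀ a b, p.blocks (Sum.inl a) (Sum.inl b) → t a = t b

/-- Valid labelings of the lower row: connected lower points have equal labels. -/
def ValidLower {N : ℕ} (t : Fin p.l → Fin N) : Prop :=
  ∀ a b, p.blocks (Sum.inr a) (Sum.inr b) → t a = t b

/-- The set `T_i` of all valid labelings of the upper row with through-block labeling `i`. The
index set `{1, …, r}` with `r = N ^ tb(p)` is realised as the set of all labelings of the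
through-blocks. -/
def upperClass {N : ℕ} (i : p.ThroughBlock → Fin N) : Set (Fin p.k → Fin N) :=
  {t | p.ValidUpper t ∧
    ∀ (b : p.ThroughBlock) (a : Fin p.k), Quotient.mk p.blocks (Sum.inl a) = b.1 → t a = i b}

/-- The set `T'_i` of all valid labelings of the lower row with through-block labeling `i`. -/
def lowerClass {N : ℕ} (i : p.ThroughBlock → Fin N) : Set (Fin p.l → Fin N) :=
  {t | p.ValidLower t ∧
    ∀ (b : p.ThroughBlock) (a : Fin p.l), Quotient.mk p.blocks (Sum.inr a) = b.1 → t a = i b}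

/-! ### Quantum space relations -/

variable {N d : ℕ} {A : Type u} [Ring A] [StarRing A]

open Classical in
/-- `∑_{t ∈ T_i} x_{t₁γ₁}^{ω₁} ⋯ x_{t_kγ_k}^{ω_k}`. -/
def upperSum (x : Fin N → Fin d → A) (i : p.ThroughBlock → Fin N) (γ : Fin p.k → Fin d) : A :=
  ∑ t : Fin p.k → Fin N with t ∈ p.upperClass i,
    (List.ofFn fun a => (p.upper a).pow (x (t a) (γ a))).prod

open Classical in
/-- `∑_{t' ∈ T'_i} x_{t'₁γ'₁}^{ω'₁} ⋯ x_{t'_lγ'_l}^{ω'_l}`. -/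
def lowerSum (x : Fin N → Fin d → A) (i : p.ThroughBlock → Fin N) (γ : Fin p.l → Fin d) : A :=
  ∑ t : Fin p.l → Fin N with t ∈ p.lowerClass i,
    (List.ofFn fun a => (p.lower a).pow (x (t a) (γ a))).prod

/-- The quantum space relations `R^{Sp}_p(x)` of a partition `p` for a tuple `x` of `d ≤ N` vectors
of length `N`; the set `[d]` is regarded as a subset of `[N]`. -/
structure SpaceRelations (hd : d ≤ N) (x : Fin N → Fin d → A) : Prop where
  valid : ∀ (i j : p.ThroughBlock → Fin N) (γ : Fin p.k → Fin d) (γ' : Fin p.l → Fin d),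
    (fun a => Fin.castLE hd (γ a)) ∈ p.upperClass j →
    (fun a => Fin.castLE hd (γ' a)) ∈ p.lowerClass j →
    p.upperSum x i γ = p.lowerSum x i γ'
  upper_invalid : ∀ (i : p.ThroughBlock → Fin N) (γ : Fin p.k → Fin d),
    ¬ p.ValidUpper (fun a => Fin.castLE hd (γ a)) → p.upperSum x i γ = 0
  lower_invalid : ∀ (i : p.ThroughBlock → Fin N) (γ' : Fin p.l → Fin d),
    ¬ p.ValidLower (fun a => Fin.castLE hd (γ' a)) → p.lowerSum x i γ' = 0

end TwoColouredPartition

open TwoColouredPartition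

/-- The relations for the pair partition with lower colours white, black bound the generators. -/
lemma norm_le_one_of_spaceRelations {N d : ℕ} (hd : d ≤ N) {B : Type u} [CStarAlgebra B]
    (x : Fin N → Fin d → B) (h : (lowerPair .white .black).SpaceRelations hd x)
    (i : Fin N) (j : Fin d) : ‖x i j‖ ≤ 1 := by
  have hE : ∀ b : (lowerPair .white .black).ThroughBlock, False := by
    rintro ⟨b, ⟨a, _⟩, _⟩
    exact a.elim0
  have h1 := h.valid (fun b => (hE b).elim) (fun b => (hE b).elim) (fun a => a.elim0) (fun _ => j)
    ⟨fun a => a.elim0, fun b => (hE b).elim⟩ ⟨fun _ _ _ => rfl, fun b => (hE b).elim⟩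
  have h2 : upperSum (lowerPair .white .black) x (fun b => (hE b).elim) (fun a => a.elim0) = 1 := by
    classical
    unfold upperSum
    rw [Finset.sum_eq_single_of_mem (fun a => a.elim0)]
    · simp [lowerPair, oneBlock]
    · simp only [Finset.mem_filter, Finset.mem_univ, true_and]
      exact ⟨fun a => a.elim0, fun b => (hE b).elim⟩
    · intro t _ ht
      exact (ht (funext fun a => a.elim0)).elim
  have h3 : lowerSum (lowerPair .white .black) x (fun b => (hE b).elim) (fun _ => j) =
      ∑ t, x t j * star (x t j) := by
    classical
    unfold lowerSum
    symm
    refine Finset.sum_bij (fun t _ _ => t) ?_ ?_ ?_ ?_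
    · intro t _
      simp only [Finset.mem_filter, Finset.mem_univ, true_and]
      exact ⟨fun _ _ _ => rfl, fun b => (hE b).elim⟩
    · intro t _ t' _ h
      exact congrFun h (0 : Fin 2)
    · intro t ht
      simp only [Finset.mem_filter, Finset.mem_univ, true_and] at ht
      exact ⟨t (0 : Fin 2), Finset.mem_univ _, funext fun a => ht.1 _ _ trivial⟩
    · intro t _
      simp [lowerPair, oneBlock, Colour.pow, List.ofFn_succ]
  rw [h2, h3] at h1
  let _ := CStarAlgebra.spectralOrder B
  have := CStarAlgebra.spectralOrderedRing B
  have h4 : x i j * star (x i j) ≤ 1 := by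
    rw [h1]
    exact Finset.single_le_sum (f := fun t => x t j * star (x t j))
      (fun t _ => mul_star_self_nonneg _) (Finset.mem_univ i)
  have h5 := CStarAlgebra.norm_le_norm_of_nonneg_of_le (mul_star_self_nonneg _) h4
  rw [CStarRing.norm_self_mul_star] at h5
  have h6 : ‖(1 : B)‖ ≤ 1 := by
    rcases subsingleton_or_nontrivial B with hB | hB
    · rw [Subsingleton.elim (1 : B) 0]; simp
    · simp
  nlinarith [norm_nonneg (x i j)]

/-! ### Partition quantum spaces -/

section PQS

variable (N d : ℕ) (hd : d ≤ N) (P : Set TwoColouredPartition) (hP : mixedPairs ⊆ P)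

/-- The relations `R^{Sp}_p(x)`, `p ∈ P`, on generators `x_{ij}` with `i ∈ [N]`, `j ∈ [d]`. -/
def pqsRelations : CStarRelations.{u} (ULift.{u} (Fin N × Fin d)) where
  Holds _ _ y := ∀ p ∈ P, p.SpaceRelations hd fun i j => y ⟨(i, j)⟩
  bounded x := ⟨1, fun _ _ y hy => norm_le_one_of_spaceRelations hd (fun i j => y ⟨(i, j)⟩)
    (hy _ (hP (by simp [mixedPairs]))) x.down.1 x.down.2⟩

/-- The C⋆-algebra `C(X_{N,d}(P))` of the partition quantum space `X_{N,d}(P)` of `d` vectors. -/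
abbrev PQS : Type u := (pqsRelations.{u} N d hd P hP).Universal

/-- The generators `x_{ij}` of `C(X_{N,d}(P))`. -/
def pqsGen (i : Fin N) (j : Fin d) : PQS.{u} N d hd P hP :=
  (pqsRelations.{u} N d hd P hP).gen ⟨(i, j)⟩

end PQS

/-! ### Compact matrix quantum groups and quantum symmetry groups -/

/-- A compact matrix quantum group `G`, given by the unital C⋆-algebra `C(G)` and its matrix `u`. -/
structure CMQG (N : ℕ) where
  /-- The C⋆-algebra `C(G)`. -/
  carrier : Type u
  [cstar : CStarAlgebra carrier]
  /-- The matrix of generators. -/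
  u : Matrix (Fin N) (Fin N) carrier
  generates : (StarAlgebra.adjoin ℂ
    (Set.range fun ij : Fin N × Fin N => u ij.1 ij.2)).topologicalClosure = ⊤
  isUnit : IsUnit u
  isUnit_conj : IsUnit (u.map star)
  exists_comul : ∃ Δ : carrier →⋆ₐ[ℂ] MinTensor carrier carrier,
    ∀ i j, Δ (u i j) = ∑ k, minTmul (u i k) (u k j)

attribute [instance] CMQG.cstar

namespace CMQG

variable {N d : ℕ}

/-- `G.IsSubgroup G'` means `G ⊆ G'`: there is a ⋆-homomorphism `C(G') → C(G)` mapping the entries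
of the matrix of `G'` to those of the matrix of `G`. -/
def IsSubgroup (G G' : CMQG.{u} N) : Prop :=
  ∃ φ : G'.carrier →⋆ₐ[ℂ] G.carrier, ∀ i j, φ (G'.u i j) = G.u i j

/-- `G` and `G'` are equal as compact matrix quantum groups: there is a ⋆-isomorphism
`C(G) ≅ C(G')` identifying the matrices of generators. -/
def Same (G G' : CMQG.{u} N) : Prop :=
  ∃ φ : G.carrier ≃⋆ₐ[ℂ] G'.carrier, ∀ i j, φ (G.u i j) = G'.u i j

variable {B : Type u} [CStarAlgebra B]

/-- Left and right matrix-vector actions of `G` on the quantum space with algebra `B` and the `d`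
vectors `x` of generators. -/
structure HasActions (G : CMQG.{u} N) (x : Fin N → Fin d → B) : Prop where
  left : ∃ α : B →⋆ₐ[ℂ] MinTensor G.carrier B, ∀ i j, α (x i j) = ∑ k, minTmul (G.u i k) (x k j)
  right : ∃ β : B →⋆ₐ[ℂ] MinTensor G.carrier B, ∀ i j, β (x i j) = ∑ k, minTmul (G.u k i) (x k j)

/-- `G` is the quantum symmetry group of the quantum space of vectors `(B, x)`: it is the maximal
compact matrix quantum group with left and right matrix-vector actions on it. -/
structure IsQuantumSymmetryGroup (G : CMQG.{u} N) (x : Fin N → Fin d → B) : Prop where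
  hasActions : G.HasActions x
  maximal : ∀ G' : CMQG.{u} N, G'.HasActions x → G'.IsSubgroup G

end CMQG

end

/-! Being a quantum symmetry group only involves the class of compact matrix quantum groups that act
from both sides. It therefore suffices that this class depends only on ⟨Π⟩ and has a largest member.
The algebras of the two quantum spaces are never compared.

Actions. G acts on X_{N,N}(Π) from both sides iff u and its transpose satisfy the relations of every
p ∈ Π, i.e. u is `Admissible` (`hasActions_pqsGen_iff`). If u is admissible, then α and β exist
because a matrix product of two solutions with commuting entries is again a solution
(`SpaceRelations.mul`). Conversely, the unit matrix solves all the relations, so x_ij ↦ δ_ij is a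
classical point ε of the quantum space, and id ⊗ ε sends α(x_ij) to u_ij and β(x_ij) to u_ji
(`spaceRelations_of_action`).

Categories. Let T_p be the 0-1 matrix of compatible pairs of row labelings. The relations of x
control partial column sums of the tensor powers of x, whereas intertwining by T_p equates column
sums with row sums. The bridge is double counting: on a T_i × T_j submatrix with constant column
sums and constant row sums the two constants agree, since |T_i| = |T_j| (`eq_of_upperSum_eq`). Hence
x is admissible iff T_p and its transpose intertwine the tensor powers of x for all p ∈ Π
(`admissible_iff_intertwines`). The partitions with this property form a category
(`isCategory_intertwines`), because p ↦ T_p turns tensor product, involution and composition into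
Kronecker product, transpose and, up to a positive integer, matrix product. So admissibility depends
only on ⟨Π⟩ (`admissible_congr`).

Existence. The largest member is the universal C⋆-algebra of an admissible matrix
(`easyQuantumGroup`). The mixed pairs bound the generators and make u and its conjugate invertible,
`SpaceRelations.mul` provides the comultiplication, and the universal property is maximality. -/

noncomputable section

/-! ### Homomorphisms out of completions -/

namespace CStarSeminorm

section

variable {A : Type u} [Ring A] [StarRing A] [Algebra ℂ A]

lemma le_sup {S : Set (CStarSeminorm A)} (hS : ∀ a, ∃ C, ∀ q ∈ S, q.toFun a ≤ C)
    {q : CStarSeminorm A} (hq : q ∈ S) (a : A) : q.toFun a ≤ (sup S hS).toFun a := by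
  obtain ⟨C, hC⟩ := hS a
  exact le_ciSup (f := fun q : S => q.1.toFun a)
    ⟨C, by rintro _ ⟨q, rfl⟩; exact hC q.1 q.2⟩ ⟨q, hq⟩

lemma sup_eq_zero {S : Set (CStarSeminorm A)} (hS : ∀ a, ∃ C, ∀ q ∈ S, q.toFun a ≤ C)
    {a : A} (h : ∀ q ∈ S, q.toFun a = 0) : (sup S hS).toFun a = 0 :=
  le_antisymm (Real.iSup_le (fun q => (h q.1 q.2).le) le_rfl) ((sup S hS).nonneg a)

end

variable {A : Type u} [Ring A] [StarRing A] [Algebra ℂ A] [StarModule ℂ A] (q : CStarSeminorm A)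

lemma norm_toCompletion (a : A) : ‖q.toCompletion a‖ = q.toFun a :=
  UniformSpace.Completion.norm_coe (E := q.Pre) a

lemma denseRange_toCompletion : DenseRange q.toCompletion :=
  UniformSpace.Completion.denseRange_coe (α := q.Pre)

/-- A ⋆-homomorphism dominated by `q` extends to the completion. -/
lemma exists_lift {B : Type v} [CStarAlgebra B] (π : A →⋆ₐ[ℂ] B)
    (hπ : ∀ a, ‖π a‖ ≤ q.toFun a) :
    ∃ φ : q.Completion →⋆ₐ[ℂ] B, ∀ a, φ (q.toCompletion a) = π a := by
  let f : q.Pre →+* B := (π : A →+* B)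
  have hf : Continuous f := AddMonoidHomClass.continuous_of_bound f 1 fun a => by
    rw [one_mul]; exact hπ a
  let g : q.Completion →+* B := UniformSpace.Completion.extensionHom f hf
  have hg : ∀ a : A, g (q.toCompletion a) = π a := fun a =>
    UniformSpace.Completion.extensionHom_coe f hf a
  have hgc : Continuous g := UniformSpace.Completion.continuous_extension
  refine ⟨{ g with
    commutes' := fun c => ?_
    map_star' := fun x => ?_ }, hg⟩
  · have h := hg (algebraMap ℂ A c)
    rw [AlgHomClass.commutes q.toCompletion, AlgHomClass.commutes π] at h
    exact h
  · change g (star x) = star (g x)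
    refine q.denseRange_toCompletion.induction_on x
      (isClosed_eq (hgc.comp continuous_star) (continuous_star.comp hgc)) fun a => ?_
    rw [← StarHomClass.map_star q.toCompletion, hg, hg, StarHomClass.map_star]

end CStarSeminorm

/-! ### The universal property -/

namespace FreeStarAlgebra

variable {X : Type u}

lemma star_of (x : X) : star (of x) = letter x .black := by
  rw [star_def, of, starHom_letter]; rfl

lemma eval_of {B : Type v} [Ring B] [StarRing B] [Algebra ℂ B] [StarModule ℂ B] (y : X → B)
    (x : X) : eval y (of x) = y x := eval_letter y x .white

end FreeStarAlgebra

namespace CStarRelations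

variable {X : Type u} (R : CStarRelations X)

/-- Evaluation at `y` is one of the homomorphisms in the supremum defining the universal seminorm,
so it is dominated by that seminorm and extends to the completion. -/
lemma exists_lift {B : Type u} [CStarAlgebra B] {y : X → B} (hy : R.Holds B y) :
    ∃ φ : R.Universal →⋆ₐ[ℂ] B, ∀ x, φ (R.gen x) = y x := by
  obtain ⟨φ, hφ⟩ := R.universalSeminorm.exists_lift (FreeStarAlgebra.eval y) fun a => by
      refine CStarSeminorm.le_sup (q := CStarSeminorm.ofStarAlgHom (FreeStarAlgebra.eval y)) _ ?_ a
      exact ⟨B, _, y, hy, rfl⟩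
  exact ⟨φ, fun x => by rw [gen, hφ, FreeStarAlgebra.eval_of]⟩

/-- A ⋆-polynomial that vanishes on all families satisfying the relations vanishes at the
generators of the universal algebra. -/
lemma toCompletion_eq_zero {a : FreeStarAlgebra X}
    (ha : ∀ (B : Type u) [CStarAlgebra B] (y : X → B), R.Holds B y →
      FreeStarAlgebra.eval y a = 0) :
    R.universalSeminorm.toCompletion a = 0 := by
  rw [← norm_eq_zero, CStarSeminorm.norm_toCompletion]
  refine CStarSeminorm.sup_eq_zero _ ?_
  rintro _ ⟨B, _, y, hy, rfl⟩
  change ‖FreeStarAlgebra.eval y a‖ = 0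
  rw [ha B y hy, norm_zero]

/-- The images of ⋆-polynomials are dense in the completion, and each is a polynomial in the
generators and their adjoints. -/
lemma adjoin_gen_topologicalClosure :
    (StarAlgebra.adjoin ℂ (Set.range R.gen)).topologicalClosure = ⊤ := by
  refine eq_top_iff.2 fun z _ => ?_
  refine R.universalSeminorm.denseRange_toCompletion.induction_on z
    (StarSubalgebra.isClosed_topologicalClosure _) fun a => ?_
  refine StarSubalgebra.le_topologicalClosure _ ?_
  have hof : ∀ x, R.universalSeminorm.toCompletion (FreeStarAlgebra.of x) ∈
      StarAlgebra.adjoin ℂ (Set.range R.gen) := fun x =>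
    StarAlgebra.subset_adjoin ℂ _ ⟨x, rfl⟩
  induction a using FreeStarAlgebra.induction with
  | algebraMap r => rw [AlgHomClass.commutes]; exact algebraMap_mem _ r
  | letter x c =>
    cases c with
    | white => exact hof x
    | black => rw [← FreeStarAlgebra.star_of, map_star]; exact star_mem (hof x)
  | mul a b ha hb => rw [map_mul]; exact mul_mem ha hb
  | add a b ha hb => rw [map_add]; exact add_mem ha hb

end CStarRelations

/-- ⋆-homomorphisms of C⋆-algebras are contractive, so their equalizer is a closed ⋆-subalgebra. -/
lemma StarAlgHom.eq_of_eqOn_generators {A B : Type*} [CStarAlgebra A] [CStarAlgebra B] {s : Set A}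
    (hs : (StarAlgebra.adjoin ℂ s).topologicalClosure = ⊤) {φ ψ : A →⋆ₐ[ℂ] B}
    (h : Set.EqOn φ ψ s) : φ = ψ := by
  have hφ : Continuous φ := AddMonoidHomClass.continuous_of_bound φ 1 fun a => by
    rw [one_mul]; exact NonUnitalStarAlgHom.norm_apply_le φ a
  have hψ : Continuous ψ := AddMonoidHomClass.continuous_of_bound ψ 1 fun a => by
    rw [one_mul]; exact NonUnitalStarAlgHom.norm_apply_le ψ a
  have hle : StarAlgebra.adjoin ℂ s ≤ StarAlgHom.equalizer φ ψ :=
    StarAlgebra.adjoin_le h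
  have hcl : IsClosed (StarAlgHom.equalizer φ ψ : Set A) := isClosed_eq hφ hψ
  have htop := StarSubalgebra.topologicalClosure_minimal hle hcl
  rw [hs] at htop
  exact StarAlgHom.ext fun a => htop (StarSubalgebra.mem_top (R := ℂ) (x := a))

/-! ### Representations separate points -/

section Separation

variable {A : Type u} [CStarAlgebra A]

/-- The complexification of a real functional on a C⋆-algebra, using real and imaginary parts. -/
def complexify (g : A →ₗ[ℝ] ℝ) : A →ₗ[ℂ] ℂ where
  toFun a := (g (realPart a : A) : ℂ) + Complex.I * (g (imaginaryPart a : A) : ℂ)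
  map_add' a b := by
    simp only [map_add, AddSubgroup.coe_add, Complex.ofReal_add]
    ring
  map_smul' c a := by
    rw [realPart_smul, imaginaryPart_smul]
    apply Complex.ext <;> simp

lemma complexify_of_isSelfAdjoint (g : A →ₗ[ℝ] ℝ) {a : A} (ha : IsSelfAdjoint a) :
    complexify g a = g a := by
  simp [complexify, ha.coe_realPart, ha.imaginaryPart]

/-- The representations of a C⋆-algebra on Hilbert spaces separate points. -/
theorem exists_representation_ne_zero {a : A} (ha : a ≠ 0) :
    ∃ (H : Type u) (_ : NormedAddCommGroup H) (_ : InnerProductSpace ℂ H) (_ : CompleteSpace H)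
      (π : A →⋆ₐ[ℂ] (H →L[ℂ] H)), π a ≠ 0 := by
  let _ := CStarAlgebra.spectralOrder A
  have := CStarAlgebra.spectralOrderedRing A
  -- Hahn–Banach: a real functional that is nonnegative on the closed cone of positive elements and
  -- negative at -a⋆a complexifies to a positive functional `f` with f(a⋆a) ≠ 0. Its GNS
  -- representation does not kill `a`.
  let C : ProperCone ℝ A :=
    { carrier := {a | 0 ≤ a}
      add_mem' := fun {a b} (ha : 0 ≤ a) (hb : 0 ≤ b) => add_nonneg ha hb
      zero_mem' := le_refl (0 : A)
      smul_mem' := fun c a (ha : 0 ≤ a) => smul_nonneg c.2 ha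
      isClosed' := CStarAlgebra.isClosed_nonneg }
  have hb : -(star a * a) ∉ C := fun h => by
    have h1 : star a * a ≤ 0 := neg_nonneg.1 h
    have h2 := le_antisymm h1 (star_mul_self_nonneg a)
    exact ha ((CStarRing.star_mul_self_eq_zero_iff a).1 h2)
  obtain ⟨g, hg, hgb⟩ := C.hyperplane_separation_point hb
  let f : A →ₚ[ℂ] ℂ := PositiveLinearMap.mk₀ (complexify (g : A →ₗ[ℝ] ℝ)) fun x hx => by
    rw [complexify_of_isSelfAdjoint _ (IsSelfAdjoint.of_nonneg hx)]
    exact Complex.zero_le_real.2 (hg x hx)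
  refine ⟨f.GNS, inferInstance, inferInstance, inferInstance, f.gnsStarAlgHom, fun h => ?_⟩
  -- The vector of the unit is sent to the class of `a`, whose squared norm is f(a⋆a).
  have h1 : f.gnsNonUnitalStarAlgHom a ((f.toPreGNS 1 : f.PreGNS) : f.GNS) = 0 :=
    congrArg (fun T : f.GNS →L[ℂ] f.GNS => T (f.toPreGNS 1 : f.PreGNS)) h
  rw [PositiveLinearMap.gnsNonUnitalStarAlgHom_apply_coe,
    PositiveLinearMap.leftMulMapPreGNS_apply, ← norm_eq_zero, UniformSpace.Completion.norm_coe]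
    at h1
  have h2 := f.preGNS_norm_sq (f.toPreGNS (a * 1))
  rw [mul_one] at h2
  simp only [PositiveLinearMap.ofPreGNS_toPreGNS, mul_one] at h1 h2
  rw [h1] at h2
  have h3 : f (star a * a) = g (star a * a) :=
    complexify_of_isSelfAdjoint _ (IsSelfAdjoint.star_mul_self a)
  rw [h3] at h2
  have h4 : g (star a * a) = 0 := by
    have : ((g (star a * a) : ℝ) : ℂ) = 0 := by rw [← h2]; simp
    exact_mod_cast this
  rw [map_neg, h4] at hgb
  simp at hgb

end Separation

/-! ### Elementary tensors in the minimal tensor product -/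

section MinTensor

variable {A B : Type u} [CStarAlgebra A] [CStarAlgebra B]

/-- The embedding `a ↦ a ⊗ 1` into the minimal tensor product. -/
def minTensorLeft : A →⋆ₐ[ℂ] MinTensor A B :=
  (minSeminorm A B).toCompletion.comp
    { (Algebra.TensorProduct.includeLeft : A →ₐ[ℂ] A ⊗[ℂ] B) with
      map_star' := fun a => by
        change star a ⊗ₜ[ℂ] (1 : B) = star (a ⊗ₜ[ℂ] (1 : B))
        rw [TensorProduct.star_tmul, star_one] }

/-- The embedding `b ↦ 1 ⊗ b` into the minimal tensor product. -/
def minTensorRight : B →⋆ₐ[ℂ] MinTensor A B :=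
  (minSeminorm A B).toCompletion.comp
    { (Algebra.TensorProduct.includeRight : B →ₐ[ℂ] A ⊗[ℂ] B) with
      map_star' := fun b => by
        change (1 : A) ⊗ₜ[ℂ] star b = star ((1 : A) ⊗ₜ[ℂ] b)
        rw [TensorProduct.star_tmul, star_one] }

lemma minTensorLeft_apply (a : A) : minTensorLeft (B := B) a = minTmul a 1 := rfl

lemma minTensorRight_apply (b : B) : minTensorRight (A := A) b = minTmul 1 b := rfl

lemma minTmul_mul_minTmul (a a' : A) (b b' : B) :
    minTmul a b * minTmul a' b' = minTmul (a * a') (b * b') := by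
  rw [minTmul, minTmul, ← map_mul, Algebra.TensorProduct.tmul_mul_tmul, minTmul]

lemma minTensorLeft_mul_minTensorRight (a : A) (b : B) :
    minTensorLeft a * minTensorRight b = minTmul a b := by
  rw [minTensorLeft_apply, minTensorRight_apply, minTmul_mul_minTmul, mul_one, one_mul]

/-- This commutation is what allows the two legs of a tensor product to be multiplied as commuting
solutions of the relations. -/
lemma commute_minTensorLeft_minTensorRight (a : A) (b : B) :
    Commute (minTensorLeft (B := B) a) (minTensorRight b) := by
  rw [commute_iff_eq, minTensorLeft_mul_minTensorRight, minTensorLeft_apply,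
    minTensorRight_apply, minTmul_mul_minTmul, mul_one, one_mul]

/-- The tensor product of two representations extends to the minimal tensor product. -/
lemma exists_tensorRep_lift {H K : Type u} [NormedAddCommGroup H] [InnerProductSpace ℂ H]
    [CompleteSpace H] [NormedAddCommGroup K] [InnerProductSpace ℂ K] [CompleteSpace K]
    (π : A →⋆ₐ[ℂ] (H →L[ℂ] H)) (ρ : B →⋆ₐ[ℂ] (K →L[ℂ] K)) :
    ∃ φ : MinTensor A B →⋆ₐ[ℂ] (HilbertTensor H K →L[ℂ] HilbertTensor H K),
      ∀ a b, φ (minTmul a b) = opTensor (π a) (ρ b) := by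
  obtain ⟨φ, hφ⟩ := (minSeminorm A B).exists_lift (tensorRep π ρ) fun t => by
      refine CStarSeminorm.le_sup (q := CStarSeminorm.ofStarAlgHom (tensorRep π ρ)) _ ?_ t
      exact ⟨H, K, _, _, _, _, _, _, π, ρ, rfl⟩
  exact ⟨φ, fun a b => by rw [minTmul, hφ, tensorRep_tmul]⟩

/-- The norm is multiplicative on elementary tensors: ‖Sx ⊗ y‖ = ‖Sx‖ ‖y‖ for a fixed y ≠ 0. -/
lemma opTensor_one_right_injective {H K : Type u} [NormedAddCommGroup H] [InnerProductSpace ℂ H]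
    [NormedAddCommGroup K] [InnerProductSpace ℂ K] [Nontrivial K] {S : H →L[ℂ] H}
    (hS : opTensor S (1 : K →L[ℂ] K) = 0) : S = 0 := by
  obtain ⟨y, hy⟩ := exists_ne (0 : K)
  ext x
  have h1 := congrArg (fun T : HilbertTensor H K →L[ℂ] HilbertTensor H K =>
    ‖T (HilbertTensor.of (x ⊗ₜ[ℂ] y))‖) hS
  simpa [opTensor_of, hy] using h1

end MinTensor


/-! ### Row labelings -/

namespace TwoColouredPartition

section Labelings

variable (p : TwoColouredPartition) {N n : ℕ}

instance : Finite p.ThroughBlock := inferInstanceAs (Finite {_b : Quotient p.blocks // _})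

instance : Fintype p.ThroughBlock := Fintype.ofFinite _

/-- The labelings of a row of points `e` that are constant on blocks and restrict to the labeling
`i` of the through-blocks. -/
def rowClass (e : Fin n → Fin p.k ⊕ Fin p.l) (i : p.ThroughBlock → Fin N) :
    Set (Fin n → Fin N) :=
  {t | (∀ a b, p.blocks (e a) (e b) → t a = t b) ∧
    ∀ (b : p.ThroughBlock) (a : Fin n), Quotient.mk p.blocks (e a) = b.1 → t a = i b}

lemma upperClass_eq_rowClass (i : p.ThroughBlock → Fin N) :
    p.upperClass i = p.rowClass Sum.inl i := rfl

variable {p} {e : Fin n → Fin p.k ⊕ Fin p.l}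

/-- The assumption `he` holds for both the upper and the lower row, since a through-block meets
both. Together with the next lemma it says that the classes partition the valid labelings of the
row. -/
lemma eq_of_mem_rowClass (he : ∀ b : p.ThroughBlock, ∃ a, Quotient.mk p.blocks (e a) = b.1)
    {i j : p.ThroughBlock → Fin N} {t : Fin n → Fin N} (hi : t ∈ p.rowClass e i)
    (hj : t ∈ p.rowClass e j) : i = j := by
  funext b
  obtain ⟨a, ha⟩ := he b
  rw [← hi.2 b a ha, hj.2 b a ha]

lemma exists_mem_rowClass (he : ∀ b : p.ThroughBlock, ∃ a, Quotient.mk p.blocks (e a) = b.1)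
    {t : Fin n → Fin N} (ht : ∀ a b, p.blocks (e a) (e b) → t a = t b) :
    ∃ i, t ∈ p.rowClass e i := by
  choose s hs using he
  refine ⟨fun b => t (s b), ht, fun b a ha => ht _ _ (Quotient.exact ?_)⟩
  rw [ha, hs]

lemma rowClass_nonempty [NeZero N] (e : Fin n → Fin p.k ⊕ Fin p.l)
    (i : p.ThroughBlock → Fin N) : (p.rowClass e i).Nonempty := by
  classical
  -- Blocks that are not through-blocks are unconstrained by `i` and receive the default label 0.
  let g : Quotient p.blocks → Fin N := fun c =>
    if h : (∃ a, Quotient.mk p.blocks (Sum.inl a) = c) ∧ ∃ a, Quotient.mk p.blocks (Sum.inr a) = c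
    then i ⟨c, h⟩ else 0
  refine ⟨fun a => g (Quotient.mk p.blocks (e a)), fun a b hab => ?_, fun b a ha => ?_⟩
  · exact congrArg g (Quotient.sound hab)
  · change g _ = _
    rw [ha]
    exact dif_pos b.2

/-- With labels added modulo `N`, the valid labelings form a group and the classes are cosets of the
class of 0. -/
lemma add_mem_rowClass [NeZero N] {i j : p.ThroughBlock → Fin N} {t s : Fin n → Fin N}
    (ht : t ∈ p.rowClass e i) (hs : s ∈ p.rowClass e j) : t + s ∈ p.rowClass e (i + j) :=
  ⟨fun a b h => by rw [Pi.add_apply, Pi.add_apply, ht.1 a b h, hs.1 a b h],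
    fun b a h => by rw [Pi.add_apply, Pi.add_apply, ht.2 b a h, hs.2 b a h]⟩

lemma sub_mem_rowClass [NeZero N] {i j : p.ThroughBlock → Fin N} {t s : Fin n → Fin N}
    (ht : t ∈ p.rowClass e i) (hs : s ∈ p.rowClass e j) : t - s ∈ p.rowClass e (i - j) :=
  ⟨fun a b h => by rw [Pi.sub_apply, Pi.sub_apply, ht.1 a b h, hs.1 a b h],
    fun b a h => by rw [Pi.sub_apply, Pi.sub_apply, ht.2 b a h, hs.2 b a h]⟩

-- Translation by an element of class `j - i` is a bijection between the classes. The double count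
-- in `eq_of_upperSum_eq` rests on this.
open Classical in
lemma card_rowClass_eq [NeZero N] (e : Fin n → Fin p.k ⊕ Fin p.l)
    (i j : p.ThroughBlock → Fin N) :
    (Finset.univ.filter (· ∈ p.rowClass e i)).card =
      (Finset.univ.filter (· ∈ p.rowClass e j)).card := by
  obtain ⟨τ, hτ⟩ := p.rowClass_nonempty e (j - i)
  refine Finset.card_equiv (Equiv.addRight τ) fun t => ?_
  simp only [Finset.mem_filter, Finset.mem_univ, true_and, Equiv.coe_addRight]
  refine ⟨fun h => ?_, fun h => ?_⟩
  · simpa using add_mem_rowClass h hτ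
  · simpa using sub_mem_rowClass h hτ

lemma exists_inl_of_throughBlock (b : p.ThroughBlock) :
    ∃ a, Quotient.mk p.blocks (Sum.inl a) = b.1 := b.2.1

lemma exists_inr_of_throughBlock (b : p.ThroughBlock) :
    ∃ a, Quotient.mk p.blocks (Sum.inr a) = b.1 := b.2.2

end Labelings

/-! ### Intertwiners -/

section Intertwiner

/-- A labeling of all points that is constant on the blocks. -/
def Compatible {k l N : ℕ} (r : Setoid (Fin k ⊕ Fin l)) (t : Fin k → Fin N) (t' : Fin l → Fin N) :
    Prop :=
  ∀ a b, r a b → Sum.elim t t' a = Sum.elim t t' b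

/-- A block joining an upper to a lower point is a through-block, so beyond validity of each row
compatibility only asks that both rows induce the same labels on through-blocks. -/
lemma compatible_iff (p : TwoColouredPartition) {N : ℕ} (t : Fin p.k → Fin N)
    (t' : Fin p.l → Fin N) :
    Compatible p.blocks t t' ↔ ∃ i, t ∈ p.upperClass i ∧ t' ∈ p.lowerClass i := by
  constructor
  · intro h
    obtain ⟨i, hi⟩ := exists_mem_rowClass (p := p) (t := t) exists_inl_of_throughBlock
      fun a b hab => h _ _ hab
    refine ⟨i, hi, fun a b hab => h _ _ hab, fun b a ha => ?_⟩
    obtain ⟨c, hc⟩ := b.2.1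
    rw [← hi.2 b c hc]
    exact h (Sum.inr a) (Sum.inl c) (Quotient.exact (ha.trans hc.symm))
  · rintro ⟨i, hi, hi'⟩ (a | a) (b | b) hab
    · exact hi.1 _ _ hab
    · let B : p.ThroughBlock := ⟨Quotient.mk _ (Sum.inl a), ⟨a, rfl⟩, b, Quotient.sound
        (p.blocks.symm' hab)⟩
      exact (hi.2 B a rfl).trans (hi'.2 B b (Quotient.sound (p.blocks.symm' hab))).symm
    · let B : p.ThroughBlock := ⟨Quotient.mk _ (Sum.inr a), ⟨b, Quotient.sound
        (p.blocks.symm' hab)⟩, a, rfl⟩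
      exact (hi'.2 B a rfl).trans (hi.2 B b (Quotient.sound (p.blocks.symm' hab))).symm
    · exact hi'.1 _ _ hab

variable {p : TwoColouredPartition} {N : ℕ}

/-- Row t' of T_p is thus the indicator function of the class T_i, which turns entries of matrix
products with T_p into the partial sums of the relations. -/
lemma compatible_iff_of_mem_lowerClass {i : p.ThroughBlock → Fin N} {t' : Fin p.l → Fin N}
    (ht' : t' ∈ p.lowerClass i) (t : Fin p.k → Fin N) :
    Compatible p.blocks t t' ↔ t ∈ p.upperClass i := by
  rw [compatible_iff]
  refine ⟨?_, fun ht => ⟨i, ht, ht'⟩⟩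
  rintro ⟨j, hj, hj'⟩
  rwa [eq_of_mem_rowClass (p := p) exists_inr_of_throughBlock ht' hj']

lemma compatible_iff_of_mem_upperClass {i : p.ThroughBlock → Fin N} {t : Fin p.k → Fin N}
    (ht : t ∈ p.upperClass i) (t' : Fin p.l → Fin N) :
    Compatible p.blocks t t' ↔ t' ∈ p.lowerClass i := by
  rw [compatible_iff]
  refine ⟨?_, fun ht' => ⟨i, ht, ht'⟩⟩
  rintro ⟨j, hj, hj'⟩
  rwa [eq_of_mem_rowClass (p := p) exists_inl_of_throughBlock ht hj]

lemma Compatible.validUpper {t : Fin p.k → Fin N} {t' : Fin p.l → Fin N}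
    (h : Compatible p.blocks t t') : p.ValidUpper t := fun _ _ hab => h _ _ hab

lemma Compatible.validLower {t : Fin p.k → Fin N} {t' : Fin p.l → Fin N}
    (h : Compatible p.blocks t t') : p.ValidLower t' := fun _ _ hab => h _ _ hab

lemma ValidUpper.exists_mem {t : Fin p.k → Fin N} (h : p.ValidUpper t) :
    ∃ i, t ∈ p.upperClass i := exists_mem_rowClass (p := p) exists_inl_of_throughBlock h

lemma ValidLower.exists_mem {t : Fin p.l → Fin N} (h : p.ValidLower t) :
    ∃ i, t ∈ p.lowerClass i := exists_mem_rowClass (p := p) exists_inr_of_throughBlock h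

open Classical in
/-- The matrix of the linear map `T_p`. -/
def partitionMatrix (A : Type u) [Ring A] (N : ℕ) {k l : ℕ} (r : Setoid (Fin k ⊕ Fin l)) :
    Matrix (Fin l → Fin N) (Fin k → Fin N) A :=
  Matrix.of fun t' t => if Compatible r t t' then 1 else 0

variable {A : Type u} [Ring A]

/-- Over a noncommutative ring transposition does not reverse products in general; here it does
because one factor has entries 0 and 1. -/
lemma partitionMatrix_mul_transpose {k l : ℕ} {m : Type*} (r : Setoid (Fin k ⊕ Fin l))
    (M : Matrix m (Fin k → Fin N) A) :
    partitionMatrix A N r * M.transpose = (M * (partitionMatrix A N r).transpose).transpose := by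
  ext
  simp [Matrix.mul_apply, partitionMatrix]

lemma transpose_partitionMatrix_mul_transpose {k l : ℕ} {m : Type*} (r : Setoid (Fin k ⊕ Fin l))
    (M : Matrix m (Fin l → Fin N) A) :
    (partitionMatrix A N r).transpose * M.transpose = (M * partitionMatrix A N r).transpose := by
  ext
  simp [Matrix.mul_apply, partitionMatrix]

variable [StarRing A]

/-- The matrix `x^{⊗ω}` with entries `x_{t₁γ₁}^{ω₁} ⋯ x_{t_kγ_k}^{ω_k}`. -/
def wordMatrix {k d : ℕ} (ω : Fin k → Colour) (x : Fin N → Fin d → A) :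
    Matrix (Fin k → Fin N) (Fin k → Fin d) A :=
  Matrix.of fun t γ => (List.ofFn fun a => (ω a).pow (x (t a) (γ a))).prod

lemma wordMatrix_apply {k d : ℕ} (ω : Fin k → Colour) (x : Fin N → Fin d → A)
    (t : Fin k → Fin N) (γ : Fin k → Fin d) :
    wordMatrix ω x t γ = (List.ofFn fun a => (ω a).pow (x (t a) (γ a))).prod := rfl

/-- The transposed matrix of generators. -/
def transposed (x : Fin N → Fin N → A) : Fin N → Fin N → A := fun i j => x j i

/-- Transposing the generators keeps the order of the letters, so no commutativity is needed. -/
lemma wordMatrix_transposed {k : ℕ} (ω : Fin k → Colour) (x : Fin N → Fin N → A) :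
    wordMatrix ω (transposed x) = (wordMatrix ω x).transpose := rfl

open Classical in
lemma upperSum_eq {d : ℕ} (x : Fin N → Fin d → A) (i : p.ThroughBlock → Fin N)
    (γ : Fin p.k → Fin d) :
    p.upperSum x i γ = ∑ t with t ∈ p.upperClass i, wordMatrix p.upper x t γ := rfl

open Classical in
lemma lowerSum_eq {d : ℕ} (x : Fin N → Fin d → A) (i : p.ThroughBlock → Fin N)
    (γ : Fin p.l → Fin d) :
    p.lowerSum x i γ = ∑ t with t ∈ p.lowerClass i, wordMatrix p.lower x t γ := rfl

/-- The map `T_p` of the partition with blocks `r` intertwines the tensor powers of `x` for the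
colour words `ω` and `ω'`, and so does its transpose. -/
structure BlocksIntertwine {k l : ℕ} (ω : Fin k → Colour) (ω' : Fin l → Colour)
    (r : Setoid (Fin k ⊕ Fin l)) (x : Fin N → Fin N → A) : Prop where
  map : partitionMatrix A N r * wordMatrix ω x = wordMatrix ω' x * partitionMatrix A N r
  map_transpose : (partitionMatrix A N r).transpose * wordMatrix ω' x =
    wordMatrix ω x * (partitionMatrix A N r).transpose

variable (p) in
/-- The map `T_p` intertwines the tensor powers of `x`, and so does its transpose. -/
abbrev Intertwines (x : Fin N → Fin N → A) : Prop :=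
  BlocksIntertwine p.upper p.lower p.blocks x

lemma BlocksIntertwine.transposed {x : Fin N → Fin N → A} (h : p.Intertwines x) :
    p.Intertwines (transposed x) where
  map := by
    rw [wordMatrix_transposed, wordMatrix_transposed, partitionMatrix_mul_transpose,
      ← h.map_transpose]
    ext
    simp [Matrix.mul_apply, partitionMatrix]
  map_transpose := by
    rw [wordMatrix_transposed, wordMatrix_transposed, transpose_partitionMatrix_mul_transpose,
      ← h.map]
    ext
    simp [Matrix.mul_apply, partitionMatrix]

/-! ### Entries of the products of T_p and its transpose with tensor powers -/

section Entries

variable (x : Fin N → Fin N → A) {i : p.ThroughBlock → Fin N} {γ : Fin p.k → Fin N}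
  {γ' : Fin p.l → Fin N}

lemma partitionMatrix_mul_apply (h : γ' ∈ p.lowerClass i) (γ : Fin p.k → Fin N) :
    (partitionMatrix A N p.blocks * wordMatrix p.upper x) γ' γ = p.upperSum x i γ := by
  classical
  simp [Matrix.mul_apply, partitionMatrix, upperSum_eq, compatible_iff_of_mem_lowerClass h,
    Finset.sum_filter]

lemma partitionMatrix_mul_apply_of_not_validLower (h : ¬ p.ValidLower γ') (γ : Fin p.k → Fin N) :
    (partitionMatrix A N p.blocks * wordMatrix p.upper x) γ' γ = 0 := by
  have hc : ∀ t, ¬ Compatible p.blocks t γ' := fun _ ht => h ht.validLower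
  simp [Matrix.mul_apply, partitionMatrix, hc]

lemma mul_partitionMatrix_apply (h : γ ∈ p.upperClass i) (γ' : Fin p.l → Fin N) :
    (wordMatrix p.lower x * partitionMatrix A N p.blocks) γ' γ =
      p.lowerSum (transposed x) i γ' := by
  classical
  simp [Matrix.mul_apply, partitionMatrix, lowerSum_eq, compatible_iff_of_mem_upperClass h,
    Finset.sum_filter, wordMatrix_transposed]

lemma mul_partitionMatrix_apply_of_not_validUpper (h : ¬ p.ValidUpper γ) (γ' : Fin p.l → Fin N) :
    (wordMatrix p.lower x * partitionMatrix A N p.blocks) γ' γ = 0 := by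
  have hc : ∀ t, ¬ Compatible p.blocks γ t := fun _ ht => h ht.validUpper
  simp [Matrix.mul_apply, partitionMatrix, hc]

lemma transpose_partitionMatrix_mul_apply (h : γ ∈ p.upperClass i) (γ' : Fin p.l → Fin N) :
    ((partitionMatrix A N p.blocks).transpose * wordMatrix p.lower x) γ γ' =
      p.lowerSum x i γ' := by
  classical
  simp [Matrix.mul_apply, partitionMatrix, lowerSum_eq, compatible_iff_of_mem_upperClass h,
    Finset.sum_filter]

lemma transpose_partitionMatrix_mul_apply_of_not_validUpper (h : ¬ p.ValidUpper γ)
    (γ' : Fin p.l → Fin N) :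
    ((partitionMatrix A N p.blocks).transpose * wordMatrix p.lower x) γ γ' = 0 := by
  have hc : ∀ t, ¬ Compatible p.blocks γ t := fun _ ht => h ht.validUpper
  simp [Matrix.mul_apply, partitionMatrix, hc]

lemma mul_transpose_partitionMatrix_apply (h : γ' ∈ p.lowerClass i) (γ : Fin p.k → Fin N) :
    (wordMatrix p.upper x * (partitionMatrix A N p.blocks).transpose) γ γ' =
      p.upperSum (transposed x) i γ := by
  classical
  simp [Matrix.mul_apply, partitionMatrix, upperSum_eq, compatible_iff_of_mem_lowerClass h,
    Finset.sum_filter, wordMatrix_transposed]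

lemma mul_transpose_partitionMatrix_apply_of_not_validLower (h : ¬ p.ValidLower γ')
    (γ : Fin p.k → Fin N) :
    (wordMatrix p.upper x * (partitionMatrix A N p.blocks).transpose) γ γ' = 0 := by
  have hc : ∀ t, ¬ Compatible p.blocks t γ' := fun _ ht => h ht.validLower
  simp [Matrix.mul_apply, partitionMatrix, hc]

end Entries

variable [Algebra ℂ A]

/-- If the partial column sums and the partial row sums of `x^{⊗ω}` over a pair of classes of
labelings are constant, then they agree. -/
lemma eq_of_upperSum_eq [NeZero N] {x : Fin N → Fin N → A} {i j : p.ThroughBlock → Fin N}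
    {c c' : A} (hc : ∀ γ ∈ p.upperClass j, p.upperSum x i γ = c)
    (hc' : ∀ γ ∈ p.upperClass i, p.upperSum (transposed x) j γ = c') : c = c' := by
  classical
  -- Both sides add up the entries of the T_i × T_j submatrix, column by column and row by row.
  have h1 : ∑ γ with γ ∈ p.upperClass j, p.upperSum x i γ =
      ∑ γ with γ ∈ p.upperClass i, p.upperSum (transposed x) j γ := by
    simp only [upperSum_eq]
    rw [Finset.sum_comm]
    rfl
  rw [Finset.sum_congr rfl fun γ hγ => hc γ (Finset.mem_filter.1 hγ).2,
    Finset.sum_congr rfl fun γ hγ => hc' γ (Finset.mem_filter.1 hγ).2,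
    Finset.sum_const, Finset.sum_const] at h1
  -- Now |T_j| c = |T_i| c', and the common nonzero cardinality is cancelled as a complex scalar.
  rw [upperClass_eq_rowClass, upperClass_eq_rowClass, card_rowClass_eq Sum.inl j i,
    ← Nat.cast_smul_eq_nsmul ℂ, ← Nat.cast_smul_eq_nsmul ℂ] at h1
  refine smul_right_injective A (r := ((Finset.univ.filter
    (· ∈ p.rowClass Sum.inl i)).card : ℂ)) ?_ h1
  rw [Nat.cast_ne_zero, Finset.card_ne_zero]
  obtain ⟨t, ht⟩ := p.rowClass_nonempty Sum.inl i
  exact ⟨t, by simpa using ht⟩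

/-- At valid indices the two sides are a column sum of a tensor power of `x` and a column sum for
the transpose, that is, a row sum for `x`. The relations make each constant on its class, and
`eq_of_upperSum_eq` identifies the constants. At invalid indices both sides vanish. -/
lemma SpaceRelations.intertwines [NeZero N] {x : Fin N → Fin N → A}
    (h : p.SpaceRelations le_rfl x)
    (h' : p.SpaceRelations le_rfl (TwoColouredPartition.transposed x)) :
    p.Intertwines x where
  map := by
    ext γ' γ
    by_cases hγ' : p.ValidLower γ'
    · obtain ⟨i, hi⟩ := hγ'.exists_mem
      rw [partitionMatrix_mul_apply x hi]
      by_cases hγ : p.ValidUpper γ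
      · obtain ⟨j, hj⟩ := hγ.exists_mem
        rw [mul_partitionMatrix_apply x hj]
        -- The reference labeling `s` compares two upper column sums through one and the same lower
        -- sum.
        obtain ⟨s, hs⟩ := p.rowClass_nonempty Sum.inr j
        exact eq_of_upperSum_eq
          (fun γ₁ h₁ => (h.valid i j γ₁ s h₁ hs).trans (h.valid i j γ s hj hs).symm)
          (fun γ₁ h₁ => h'.valid j i γ₁ γ' h₁ hi)
      · rw [mul_partitionMatrix_apply_of_not_validUpper x hγ]
        exact h.upper_invalid i γ hγ
    · rw [partitionMatrix_mul_apply_of_not_validLower x hγ']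
      by_cases hγ : p.ValidUpper γ
      · obtain ⟨j, hj⟩ := hγ.exists_mem
        rw [mul_partitionMatrix_apply x hj]
        exact (h'.lower_invalid j γ' hγ').symm
      · rw [mul_partitionMatrix_apply_of_not_validUpper x hγ]
  map_transpose := by
    ext γ γ'
    by_cases hγ : p.ValidUpper γ
    · obtain ⟨j, hj⟩ := hγ.exists_mem
      rw [transpose_partitionMatrix_mul_apply x hj]
      by_cases hγ' : p.ValidLower γ'
      · obtain ⟨i, hi⟩ := hγ'.exists_mem
        rw [mul_transpose_partitionMatrix_apply x hi]
        obtain ⟨s, hs⟩ := p.rowClass_nonempty Sum.inr j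
        exact eq_of_upperSum_eq
          (fun γ₁ h₁ => h.valid j i γ₁ γ' h₁ hi)
          (fun γ₁ h₁ => (h'.valid i j γ₁ s h₁ hs).trans (h'.valid i j γ s hj hs).symm)
      · rw [mul_transpose_partitionMatrix_apply_of_not_validLower x hγ']
        exact h.lower_invalid j γ' hγ'
    · rw [transpose_partitionMatrix_mul_apply_of_not_validUpper x hγ]
      by_cases hγ' : p.ValidLower γ'
      · obtain ⟨i, hi⟩ := hγ'.exists_mem
        rw [mul_transpose_partitionMatrix_apply x hi]
        exact (h'.upper_invalid i γ hγ).symm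
      · rw [mul_transpose_partitionMatrix_apply_of_not_validLower x hγ']

/-- The same double count in reverse: `map` shows that the upper column sums are constant on T_j,
`map_transpose` that the row sums over T_j are constant on T_i and equal to the lower sum. -/
lemma BlocksIntertwine.spaceRelations [NeZero N] {x : Fin N → Fin N → A} (h : p.Intertwines x) :
    p.SpaceRelations le_rfl x where
  valid i j γ γ' hγ hγ' := by
    change γ ∈ p.upperClass j at hγ
    change γ' ∈ p.lowerClass j at hγ'
    obtain ⟨s, hs⟩ := p.rowClass_nonempty Sum.inr i
    refine eq_of_upperSum_eq (i := i) (j := j) (x := x) (fun γ₁ h₁ => ?_) (fun γ₁ h₁ => ?_)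
    · rw [← partitionMatrix_mul_apply x hs, ← partitionMatrix_mul_apply x hs, h.map,
        mul_partitionMatrix_apply x hγ, mul_partitionMatrix_apply x h₁]
    · rw [← mul_transpose_partitionMatrix_apply x hγ', ← h.map_transpose,
        transpose_partitionMatrix_mul_apply x h₁]
  upper_invalid i γ hγ := by
    obtain ⟨s, hs⟩ := p.rowClass_nonempty Sum.inr i
    rw [← partitionMatrix_mul_apply x hs, h.map]
    exact mul_partitionMatrix_apply_of_not_validUpper x hγ s
  lower_invalid i γ' hγ' := by
    obtain ⟨s, hs⟩ := p.rowClass_nonempty Sum.inl i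
    rw [← transpose_partitionMatrix_mul_apply x hs, h.map_transpose]
    exact mul_transpose_partitionMatrix_apply_of_not_validLower x hγ' s

end Intertwiner

end TwoColouredPartition


namespace TwoColouredPartition

/-! ### Intertwined partitions form a category -/

section Category

variable {N : ℕ} {A : Type u} [Ring A]

lemma compatible_comap_swap {k l : ℕ} (r : Setoid (Fin k ⊕ Fin l)) (t : Fin k → Fin N)
    (t' : Fin l → Fin N) :
    Compatible (Setoid.comap Sum.swap r) t' t ↔ Compatible r t t' := by
  have hswap : ∀ a, Sum.elim t' t a = Sum.elim t t' a.swap := by rintro (a | a) <;> rfl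
  constructor
  · intro h a b hab
    have := h a.swap b.swap (by simpa [Setoid.comap_rel] using hab)
    simpa [hswap] using this
  · intro h a b hab
    rw [hswap, hswap]
    exact h _ _ hab

lemma partitionMatrix_comap_swap {k l : ℕ} (r : Setoid (Fin k ⊕ Fin l)) :
    partitionMatrix A N (Setoid.comap Sum.swap r) = (partitionMatrix A N r).transpose := by
  ext t t'
  classical
  exact if_congr (compatible_comap_swap r t t') rfl rfl

/-- The blocks of the tensor product. -/
abbrev tensorBlocks (p q : TwoColouredPartition) :
    Setoid (Fin (p.k + q.k) ⊕ Fin (p.l + q.l)) := (tensor p q).blocks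

lemma compatible_tensor (p q : TwoColouredPartition) (t : Fin p.k → Fin N) (s : Fin q.k → Fin N)
    (t' : Fin p.l → Fin N) (s' : Fin q.l → Fin N) :
    Compatible (tensorBlocks p q) (Fin.append t s) (Fin.append t' s') ↔
      Compatible p.blocks t t' ∧ Compatible q.blocks s s' := by
  -- Regroups the points by factor instead of by row, so that the blocks are those of `p` and `q`
  -- side by side.
  let e : Fin (p.k + q.k) ⊕ Fin (p.l + q.l) ≃ (Fin p.k ⊕ Fin p.l) ⊕ (Fin q.k ⊕ Fin q.l) :=
    (Equiv.sumCongr finSumFinEquiv.symm finSumFinEquiv.symm).trans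
      (Equiv.sumSumSumComm (Fin p.k) (Fin q.k) (Fin p.l) (Fin q.l))
  have he : ∀ z, Sum.elim (Fin.append t s) (Fin.append t' s') (e.symm z) =
      Sum.elim (Sum.elim t t') (Sum.elim s s') z := by
    rintro ((a | a) | (a | a)) <;> simp [e, Equiv.sumSumSumComm]
  have hrel : ∀ z w, tensorBlocks p q (e.symm z) (e.symm w) ↔
      Sum.LiftRel p.blocks.r q.blocks.r z w := fun z w => by
    change Sum.LiftRel p.blocks.r q.blocks.r (e (e.symm z)) (e (e.symm w)) ↔ _
    rw [e.apply_symm_apply, e.apply_symm_apply]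
  constructor
  · intro h
    refine ⟨fun a b hab => ?_, fun a b hab => ?_⟩
    · have := h _ _ ((hrel (Sum.inl a) (Sum.inl b)).2 (Sum.LiftRel.inl hab))
      rwa [he, he] at this
    · have := h _ _ ((hrel (Sum.inr a) (Sum.inr b)).2 (Sum.LiftRel.inr hab))
      rwa [he, he] at this
  · rintro ⟨h, h'⟩ a b hab
    obtain ⟨z, rfl⟩ := e.symm.surjective a
    obtain ⟨w, rfl⟩ := e.symm.surjective b
    rw [he, he]
    rcases (hrel z w).1 hab with hzw | hzw
    · exact h _ _ hzw
    · exact h' _ _ hzw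

lemma partitionMatrix_tensor (p q : TwoColouredPartition) (t : Fin p.k → Fin N)
    (s : Fin q.k → Fin N) (t' : Fin p.l → Fin N) (s' : Fin q.l → Fin N) :
    partitionMatrix A N (tensorBlocks p q) (Fin.append t' s') (Fin.append t s) =
      partitionMatrix A N p.blocks t' t * partitionMatrix A N q.blocks s' s := by
  classical
  have h := compatible_tensor p q t s t' s'
  by_cases h1 : Compatible p.blocks t t' <;> by_cases h2 : Compatible q.blocks s s' <;>
    simp [partitionMatrix, h, h1, h2]

/-- The entries 0 and 1 are central. This replaces the missing commutativity when Kronecker products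
are multiplied. -/
lemma commute_partitionMatrix {k l : ℕ} (r : Setoid (Fin k ⊕ Fin l)) (t : Fin k → Fin N)
    (t' : Fin l → Fin N) (a : A) : Commute (partitionMatrix A N r t' t) a := by
  classical
  rw [partitionMatrix, Matrix.of_apply]
  split_ifs
  · exact Commute.one_left a
  · exact Commute.zero_left a

lemma sum_append {M : Type*} [AddCommMonoid M] {m n : ℕ} (f : (Fin (m + n) → Fin N) → M) :
    ∑ t, f t = ∑ a : Fin m → Fin N, ∑ b : Fin n → Fin N, f (Fin.append a b) := by
  rw [← Fintype.sum_prod_type']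
  exact (Fintype.sum_equiv (Fin.appendEquiv m n) _ _ fun _ => rfl).symm

/-! ### Composition of partitions and the product of their matrices -/

section Composition

variable {k l m : ℕ} (r : Setoid (Fin k ⊕ Fin l)) (s : Setoid (Fin l ⊕ Fin m))

/-- The joint labeling of the three rows is constant along each link, hence along chains of links
through the middle row. -/
lemma Compatible.comp {r : Setoid (Fin k ⊕ Fin l)} {s : Setoid (Fin l ⊕ Fin m)}
    {t : Fin k → Fin N} {t' : Fin l → Fin N} {t'' : Fin m → Fin N}
    (h : Compatible r t t') (h' : Compatible s t' t'') : Compatible (compBlocks r s) t t'' := by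
  have hF : ∀ x y, Relation.EqvGen (Linked r s) x y →
      Sum.elim t (Sum.elim t' t'') x = Sum.elim t (Sum.elim t' t'') y := by
    intro x y hxy
    induction hxy with
    | rel x y hxy =>
      cases hxy with
      | @above x y hxy =>
        have := h x y hxy
        rcases x with x | x <;> rcases y with y | y <;> exact this
      | below hxy => exact h' _ _ hxy
    | refl x => rfl
    | symm x y _ ih => exact ih.symm
    | trans x y z _ _ ih ih' => exact ih.trans ih'
  intro x y hxy
  have := hF _ _ hxy
  rcases x with x | x <;> rcases y with y | y <;> exact this

lemma exists_compatible_of_compBlocks [NeZero N] {t : Fin k → Fin N} {t'' : Fin m → Fin N}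
    (h : Compatible (compBlocks r s) t t'') :
    ∃ t', Compatible r t t' ∧ Compatible s t' t'' := by
  classical
  let Q := Relation.EqvGen.setoid (Linked r s)
  let o : Fin k ⊕ Fin m → Fin k ⊕ (Fin l ⊕ Fin m) := Sum.map id Sum.inr
  -- A component takes the label of any of its outer points, which is well defined by `h`.
  -- Components consisting of middle points only get the default label 0.
  let f : Quotient Q → Fin N := fun c =>
    if hc : ∃ x, Quotient.mk Q (o x) = c then Sum.elim t t'' hc.choose else 0
  have hf : ∀ x, f (Quotient.mk Q (o x)) = Sum.elim t t'' x := fun x => by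
    have hx : ∃ y, Quotient.mk Q (o y) = Quotient.mk Q (o x) := ⟨x, rfl⟩
    simp only [f, dif_pos hx]
    have hQ := Quotient.exact hx.choose_spec
    exact h _ _ hQ
  refine ⟨fun a => f (Quotient.mk Q (Sum.inr (Sum.inl a))), fun x y hxy => ?_, fun x y hxy => ?_⟩
  · have hl : ∀ x, Sum.elim t (fun a => f (Quotient.mk Q (Sum.inr (Sum.inl a)))) x =
        f (Quotient.mk Q (Sum.map id Sum.inl x)) := by
      rintro (x | x)
      · exact (hf (Sum.inl x)).symm
      · rfl
    rw [hl, hl]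
    exact congrArg f (Quotient.sound (Relation.EqvGen.rel _ _ (Linked.above hxy)))
  · have hl : ∀ x, Sum.elim (fun a => f (Quotient.mk Q (Sum.inr (Sum.inl a)))) t'' x =
        f (Quotient.mk Q (Sum.inr x)) := by
      rintro (x | x)
      · rfl
      · exact (hf (Sum.inr x)).symm
    rw [hl, hl]
    exact congrArg f (Quotient.sound (Relation.EqvGen.rel _ _ (Linked.below hxy)))

lemma Compatible.add [NeZero N] {r : Setoid (Fin k ⊕ Fin l)} {t s : Fin k → Fin N}
    {t' s' : Fin l → Fin N} (h : Compatible r t t') (h' : Compatible r s s') :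
    Compatible r (t + s) (t' + s') := fun a b hab => by
  have h1 := h a b hab
  have h2 := h' a b hab
  rcases a with a | a <;> rcases b with b | b <;> simp_all

lemma Compatible.sub [NeZero N] {r : Setoid (Fin k ⊕ Fin l)} {t s : Fin k → Fin N}
    {t' s' : Fin l → Fin N} (h : Compatible r t t') (h' : Compatible r s s') :
    Compatible r (t - s) (t' - s') := fun a b hab => by
  have h1 := h a b hab
  have h2 := h' a b hab
  rcases a with a | a <;> rcases b with b | b <;> simp_all

/-- The composition of the maps `T_p` is a positive multiple of the map of the composition. -/
lemma exists_partitionMatrix_mul_eq [NeZero N] : ∃ c : ℕ, c ≠ 0 ∧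
    partitionMatrix A N s * partitionMatrix A N r = c • partitionMatrix A N (compBlocks r s) := by
  classical
  let mid : (Fin k → Fin N) → (Fin m → Fin N) → Finset (Fin l → Fin N) := fun t t'' =>
    Finset.univ.filter fun t' => Compatible r t t' ∧ Compatible s t' t''
  -- The constant counts the middle labelings that fit zero outer labels. It is nonzero because the
  -- zero labeling is one of them.
  refine ⟨(mid 0 0).card, ?_, ?_⟩
  · rw [Finset.card_ne_zero]
    refine ⟨0, ?_⟩
    simp only [mid, Finset.mem_filter, Finset.mem_univ, true_and]
    constructor <;> rintro (a | a) (b | b) _ <;> rfl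
  · ext t'' t
    have h1 : (partitionMatrix A N s * partitionMatrix A N r) t'' t = (mid t t'').card := by
      simp only [Matrix.mul_apply, partitionMatrix, Matrix.of_apply, mul_ite, mul_one, mul_zero,
        ← ite_and, Finset.card_filter, mid, Nat.cast_sum, Nat.cast_ite, Nat.cast_one,
        Nat.cast_zero]
    rw [h1, Matrix.smul_apply, partitionMatrix, Matrix.of_apply]
    split_ifs with h
    · obtain ⟨τ, hτ, hτ'⟩ := exists_compatible_of_compBlocks r s h
      rw [nsmul_one]
      congr 1
      -- Subtracting one solution `τ` identifies the middle labelings for arbitrary compatible outer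
      -- labels with those for zero outer labels.
      refine Finset.card_equiv (Equiv.subRight τ) fun t' => ?_
      simp only [mid, Finset.mem_filter, Finset.mem_univ, true_and, Equiv.subRight_apply]
      refine ⟨fun h => ?_, fun h => ?_⟩
      · simpa using And.intro (h.1.sub hτ) (h.2.sub hτ')
      · simpa using And.intro (h.1.add hτ) (h.2.add hτ')
    · have hmid : mid t t'' = ∅ := Finset.filter_eq_empty_iff.2 fun t' _ h' => h (h'.1.comp h'.2)
      simp [hmid]

end Composition

variable [StarRing A] {x : Fin N → Fin N → A}

lemma wordMatrix_append {k l d : ℕ} (ω : Fin k → Colour) (ω' : Fin l → Colour)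
    (x : Fin N → Fin d → A) (t : Fin k → Fin N) (t' : Fin l → Fin N) (γ : Fin k → Fin d)
    (γ' : Fin l → Fin d) :
    wordMatrix (Fin.append ω ω') x (Fin.append t t') (Fin.append γ γ') =
      wordMatrix ω x t γ * wordMatrix ω' x t' γ' := by
  rw [wordMatrix_apply, wordMatrix_apply, wordMatrix_apply, ← List.prod_append,
    ← List.ofFn_fin_append]
  congr 2
  funext a
  refine Fin.addCases (fun a => ?_) (fun a => ?_) a <;> simp

lemma intertwines_idPartition (c : Colour) : (idPartition c).Intertwines x := by
  classical
  have h : partitionMatrix A N (⊤ : Setoid (Fin 1 ⊕ Fin 1)) = 1 := by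
    ext t' t
    rw [Matrix.one_apply]
    refine if_congr ⟨fun h => ?_, ?_⟩ rfl rfl
    · funext a
      exact (h (Sum.inl a) (Sum.inr a) trivial).symm
    · rintro rfl
      rintro (a | a) (b | b) _ <;> exact congrArg t' (Subsingleton.elim a b)
  have h' : BlocksIntertwine ![c] ![c] (⊤ : Setoid (Fin 1 ⊕ Fin 1)) x := by
    constructor
    · rw [h, Matrix.one_mul, Matrix.mul_one]
    · rw [h, Matrix.transpose_one, Matrix.one_mul, Matrix.mul_one]
  exact h'

/-- Reflection transposes T_p and therefore exchanges the two intertwining identities. -/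
lemma Intertwines.involution {p : TwoColouredPartition} (h : p.Intertwines x) :
    p.involution.Intertwines x := by
  have h' : BlocksIntertwine p.lower p.upper (Setoid.comap Sum.swap p.blocks) x := by
    constructor
    · rw [partitionMatrix_comap_swap]
      exact h.map_transpose
    · rw [partitionMatrix_comap_swap, Matrix.transpose_transpose]
      exact h.map
  exact h'

lemma Intertwines.tensorBlocks {p q : TwoColouredPartition} (hp : p.Intertwines x)
    (hq : q.Intertwines x) :
    BlocksIntertwine (Fin.append p.upper q.upper) (Fin.append p.lower q.lower)
      (tensorBlocks p q) x where
  map := by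
    ext γ' γ
    obtain ⟨⟨γ₁, γ₂⟩, rfl⟩ := (Fin.appendEquiv p.k q.k).surjective γ
    obtain ⟨⟨γ₁', γ₂'⟩, rfl⟩ := (Fin.appendEquiv p.l q.l).surjective γ'
    have h1 := congrFun (congrFun hp.map γ₁') γ₁
    have h2 := congrFun (congrFun hq.map γ₂') γ₂
    -- The product of the two entrywise identities is the identity for the tensor product, once the
    -- central entries of the partition matrices are moved past the letters.
    have h3 := congrArg₂ (· * ·) h1 h2
    simp only [Matrix.mul_apply, Finset.sum_mul_sum] at h3
    rw [Matrix.mul_apply, Matrix.mul_apply]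
    refine (sum_append _).trans (Eq.trans ?_ (h3.trans (Eq.trans ?_ (sum_append _).symm)))
    · refine Finset.sum_congr rfl fun a _ => Finset.sum_congr rfl fun b _ => ?_
      refine (congrArg₂ (· * ·) (partitionMatrix_tensor p q a b γ₁' γ₂')
        (wordMatrix_append p.upper q.upper x a b γ₁ γ₂)).trans ?_
      exact (commute_partitionMatrix _ _ _ _).mul_mul_mul_comm _ _
    · refine Finset.sum_congr rfl fun a _ => Finset.sum_congr rfl fun b _ => ?_
      refine Eq.trans ?_ (congrArg₂ (· * ·) (wordMatrix_append p.lower q.lower x γ₁' γ₂' a b)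
        (partitionMatrix_tensor p q γ₁ γ₂ a b)).symm
      exact (commute_partitionMatrix _ _ _ _).mul_mul_mul_comm _ _
  map_transpose := by
    ext γ γ'
    obtain ⟨⟨γ₁, γ₂⟩, rfl⟩ := (Fin.appendEquiv p.k q.k).surjective γ
    obtain ⟨⟨γ₁', γ₂'⟩, rfl⟩ := (Fin.appendEquiv p.l q.l).surjective γ'
    have h1 := congrFun (congrFun hp.map_transpose γ₁) γ₁'
    have h2 := congrFun (congrFun hq.map_transpose γ₂) γ₂'
    have h3 := congrArg₂ (· * ·) h1 h2
    simp only [Matrix.mul_apply, Finset.sum_mul_sum] at h3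
    rw [Matrix.mul_apply, Matrix.mul_apply]
    refine (sum_append _).trans (Eq.trans ?_ (h3.trans (Eq.trans ?_ (sum_append _).symm)))
    · refine Finset.sum_congr rfl fun a _ => Finset.sum_congr rfl fun b _ => ?_
      refine (congrArg₂ (· * ·) (partitionMatrix_tensor p q γ₁ γ₂ a b)
        (wordMatrix_append p.lower q.lower x a b γ₁' γ₂')).trans ?_
      exact (commute_partitionMatrix _ _ _ _).mul_mul_mul_comm _ _
    · refine Finset.sum_congr rfl fun a _ => Finset.sum_congr rfl fun b _ => ?_
      refine Eq.trans ?_ (congrArg₂ (· * ·) (wordMatrix_append p.upper q.upper x γ₁ γ₂ a b)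
        (partitionMatrix_tensor p q a b γ₁' γ₂')).symm
      exact (commute_partitionMatrix _ _ _ _).mul_mul_mul_comm _ _

variable [Algebra ℂ A]

/-- Stacking the two intertwining relations gives the relation for T_s T_r = c T, where T belongs to
the composition. The integer c ≠ 0 is cancelled over ℂ. -/
lemma BlocksIntertwine.comp [NeZero N] {k l m : ℕ} {ω : Fin k → Colour} {ω' : Fin l → Colour}
    {ω'' : Fin m → Colour} {r : Setoid (Fin k ⊕ Fin l)} {s : Setoid (Fin l ⊕ Fin m)}
    (hr : BlocksIntertwine ω ω' r x) (hs : BlocksIntertwine ω' ω'' s x) :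
    BlocksIntertwine ω ω'' (compBlocks r s) x := by
  obtain ⟨c, hc, hmul⟩ := exists_partitionMatrix_mul_eq (A := A) (N := N) r s
  have hmulT : (partitionMatrix A N r).transpose * (partitionMatrix A N s).transpose =
      c • (partitionMatrix A N (compBlocks r s)).transpose := by
    rw [transpose_partitionMatrix_mul_transpose, hmul, Matrix.transpose_smul]
  have hinj : ∀ {m n : Type} {M M' : Matrix m n A}, c • M = c • M' → M = M' := by
    intro m n M M' h
    rw [← Nat.cast_smul_eq_nsmul ℂ, ← Nat.cast_smul_eq_nsmul ℂ] at h
    exact smul_right_injective _ (Nat.cast_ne_zero.2 hc) h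
  constructor
  · refine hinj ?_
    rw [← Matrix.smul_mul, ← Matrix.mul_smul, ← hmul, Matrix.mul_assoc, hr.map, ← Matrix.mul_assoc,
      hs.map, Matrix.mul_assoc]
  · refine hinj ?_
    rw [← Matrix.smul_mul, ← Matrix.mul_smul, ← hmulT, Matrix.mul_assoc, hs.map_transpose,
      ← Matrix.mul_assoc, hr.map_transpose, Matrix.mul_assoc]

lemma isCategory_intertwines [NeZero N] (hx : ∀ p ∈ mixedPairs, p.Intertwines x) :
    IsCategory {p | p.Intertwines x} where
  id_mem c := intertwines_idPartition c
  mixedPairs_subset := hx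
  tensor_mem _ hp _ hq := Intertwines.tensorBlocks hp hq
  involution_mem _ hp := Intertwines.involution hp
  comp_mem _ _ _ _ _ hr hs := BlocksIntertwine.comp hr hs

/-- Both `x` and its transpose satisfy the quantum space relations of all partitions in `P`. -/
def Admissible (P : Set TwoColouredPartition) (x : Fin N → Fin N → A) : Prop :=
  ∀ p ∈ P, p.SpaceRelations le_rfl x ∧ p.SpaceRelations le_rfl (transposed x)

lemma admissible_iff_intertwines [NeZero N] {P : Set TwoColouredPartition} :
    Admissible P x ↔ ∀ p ∈ P, p.Intertwines x :=
  forall₂_congr fun _ _ =>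
    ⟨fun h => h.1.intertwines h.2, fun h => ⟨h.spaceRelations, h.transposed.spaceRelations⟩⟩

lemma subset_generatedCategory (P : Set TwoColouredPartition) : P ⊆ generatedCategory P :=
  fun _ hp _ hC => hC.2 hp

/-- The intertwined partitions form a category containing `P`, hence containing the category
generated by `P`. -/
lemma admissible_generatedCategory [NeZero N] {P : Set TwoColouredPartition}
    (hP : mixedPairs ⊆ P) : Admissible (generatedCategory P) x ↔ Admissible P x := by
  refine ⟨fun h p hp => h p (subset_generatedCategory P hp), fun h => ?_⟩
  rw [admissible_iff_intertwines] at h ⊢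
  exact fun p hp => hp _ ⟨isCategory_intertwines fun p hp => h p (hP hp), h⟩

/-- Admissibility only depends on the generated category of partitions. -/
theorem admissible_congr [NeZero N] {P P' : Set TwoColouredPartition} (hP : mixedPairs ⊆ P)
    (hP' : mixedPairs ⊆ P') (h : generatedCategory P = generatedCategory P') :
    Admissible P x ↔ Admissible P' x := by
  rw [← admissible_generatedCategory hP, h, admissible_generatedCategory hP']

end Category

/-! ### Products of solutions of the quantum space relations -/

section Products

variable {N d : ℕ} {A : Type u} [Ring A] [StarRing A]

lemma wordMatrix_cons {k : ℕ} (ω : Fin (k + 1) → Colour) (x : Fin N → Fin d → A)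
    (t : Fin (k + 1) → Fin N) (γ : Fin (k + 1) → Fin d) :
    wordMatrix ω x t γ =
      (ω 0).pow (x (t 0) (γ 0)) * wordMatrix (Fin.tail ω) x (Fin.tail t) (Fin.tail γ) := by
  rw [wordMatrix_apply, List.ofFn_succ, List.prod_cons]
  rfl

lemma commute_wordMatrix {k : ℕ} (ω : Fin k → Colour) {x : Fin N → Fin d → A} {c : A}
    (h : ∀ (e : Colour) i j, Commute c (e.pow (x i j))) (t : Fin k → Fin N) (γ : Fin k → Fin d) :
    Commute c (wordMatrix ω x t γ) := by
  rw [wordMatrix_apply]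
  refine Commute.list_prod_right _ _ fun y hy => ?_
  obtain ⟨a, rfl⟩ := List.mem_ofFn.1 hy
  exact h _ _ _

variable {a : Fin N → Fin N → A} {b : Fin N → Fin d → A}

/-- Expanding the word of sums and sorting the letters of `a` to the left only uses that they and
their adjoints commute with those of `b`. -/
lemma wordMatrix_mul (hab : ∀ (e e' : Colour) i j i' j',
      Commute (e.pow (a i j)) (e'.pow (b i' j'))) {k : ℕ} (ω : Fin k → Colour) :
    wordMatrix ω (fun i j => ∑ m, a i m * b m j) = wordMatrix ω a * wordMatrix ω b := by
  induction k with
  | zero =>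
    ext t γ
    simp [Matrix.mul_apply, wordMatrix_apply]
  | succ k ih =>
    ext t γ
    rw [wordMatrix_cons, ih, Matrix.mul_apply, Matrix.mul_apply,
      ← (Fin.consEquiv fun _ => Fin N).sum_comp, Fintype.sum_prod_type]
    have h0 : (ω 0).pow (∑ m, a (t 0) m * b m (γ 0)) =
        ∑ m, (ω 0).pow (a (t 0) m) * (ω 0).pow (b m (γ 0)) := by
      cases ω 0 with
      | white => rfl
      | black =>
        simp only [Colour.pow, star_sum, star_mul]
        -- On a black letter the star reverses the two factors, and commutation of the adjoints
        -- restores their order.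
        exact Finset.sum_congr rfl fun m _ => (hab .black .black _ _ _ _).symm
    rw [h0, Finset.sum_mul_sum]
    refine Finset.sum_congr rfl fun m _ => Finset.sum_congr rfl fun s _ => ?_
    rw [wordMatrix_cons, wordMatrix_cons]
    simp only [Fin.consEquiv_apply, Fin.cons_zero]
    refine Commute.mul_mul_mul_comm ?_ _ _
    exact commute_wordMatrix _ (fun e i j => (hab e _ i j _ _).symm) _ _

-- The partial sum of `a` at an intermediate labeling `σ` vanishes if `σ` is invalid and otherwise
-- depends only on the class of `σ`. The sum over `σ` thus collapses to one over classes, with `s j`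
-- representing class `j`.
open Classical in
lemma sum_upperClass_mul (p : TwoColouredPartition) [NeZero N]
    (hab : ∀ (e e' : Colour) i j i' j', Commute (e.pow (a i j)) (e'.pow (b i' j')))
    (ha : p.SpaceRelations le_rfl a) (i : p.ThroughBlock → Fin N)
    {s : (p.ThroughBlock → Fin N) → Fin p.k → Fin N} (hs : ∀ j, s j ∈ p.upperClass j)
    (γ : Fin p.k → Fin d) :
    p.upperSum (fun i j => ∑ m, a i m * b m j) i γ =
      ∑ j, p.upperSum a i (s j) * p.upperSum b j γ := by
  have h1 : p.upperSum (fun i j => ∑ m, a i m * b m j) i γ =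
      ∑ σ, p.upperSum a i σ * wordMatrix p.upper b σ γ := by
    simp only [upperSum_eq, wordMatrix_mul hab, Matrix.mul_apply, Finset.sum_mul]
    exact Finset.sum_comm
  have h2 : ∀ σ, p.upperSum a i σ * wordMatrix p.upper b σ γ =
      ∑ j, if σ ∈ p.upperClass j then p.upperSum a i (s j) * wordMatrix p.upper b σ γ else 0 := by
    intro σ
    by_cases hσ : p.ValidUpper σ
    · obtain ⟨j, hj⟩ := hσ.exists_mem
      rw [Finset.sum_eq_single_of_mem j (Finset.mem_univ j), if_pos hj]
      · obtain ⟨s', hs'⟩ := p.rowClass_nonempty Sum.inr j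
        rw [ha.valid i j σ s' hj hs', ha.valid i j (s j) s' (hs j) hs']
      · intro j' _ hj'
        exact if_neg fun h => hj' (eq_of_mem_rowClass (p := p) exists_inl_of_throughBlock h hj)
    · rw [ha.upper_invalid i σ hσ, zero_mul]
      exact (Finset.sum_eq_zero fun j _ => if_neg fun h => hσ h.1).symm
  rw [h1, Finset.sum_congr rfl fun σ _ => h2 σ, Finset.sum_comm]
  refine Finset.sum_congr rfl fun j _ => ?_
  rw [← Finset.sum_filter, ← Finset.mul_sum, upperSum_eq b]

open Classical in
lemma sum_lowerClass_mul (p : TwoColouredPartition) [NeZero N]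
    (hab : ∀ (e e' : Colour) i j i' j', Commute (e.pow (a i j)) (e'.pow (b i' j')))
    (ha : p.SpaceRelations le_rfl a) (i : p.ThroughBlock → Fin N)
    {s : (p.ThroughBlock → Fin N) → Fin p.l → Fin N} (hs : ∀ j, s j ∈ p.lowerClass j)
    (γ : Fin p.l → Fin d) :
    p.lowerSum (fun i j => ∑ m, a i m * b m j) i γ =
      ∑ j, p.lowerSum a i (s j) * p.lowerSum b j γ := by
  have h1 : p.lowerSum (fun i j => ∑ m, a i m * b m j) i γ =
      ∑ σ, p.lowerSum a i σ * wordMatrix p.lower b σ γ := by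
    simp only [lowerSum_eq, wordMatrix_mul hab, Matrix.mul_apply, Finset.sum_mul]
    exact Finset.sum_comm
  have h2 : ∀ σ, p.lowerSum a i σ * wordMatrix p.lower b σ γ =
      ∑ j, if σ ∈ p.lowerClass j then p.lowerSum a i (s j) * wordMatrix p.lower b σ γ else 0 := by
    intro σ
    by_cases hσ : p.ValidLower σ
    · obtain ⟨j, hj⟩ := hσ.exists_mem
      rw [Finset.sum_eq_single_of_mem j (Finset.mem_univ j), if_pos hj]
      · obtain ⟨s', hs'⟩ := p.rowClass_nonempty Sum.inl j
        rw [← ha.valid i j s' σ hs' hj, ← ha.valid i j s' (s j) hs' (hs j)]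
      · intro j' _ hj'
        exact if_neg fun h => hj' (eq_of_mem_rowClass (p := p) exists_inr_of_throughBlock h hj)
    · rw [ha.lower_invalid i σ hσ, zero_mul]
      exact (Finset.sum_eq_zero fun j _ => if_neg fun h => hσ h.1).symm
  rw [h1, Finset.sum_congr rfl fun σ _ => h2 σ, Finset.sum_comm]
  refine Finset.sum_congr rfl fun j _ => ?_
  rw [← Finset.sum_filter, ← Finset.mul_sum, lowerSum_eq b]

/-- The product of two commuting solutions of the quantum space relations is a solution. -/
lemma SpaceRelations.mul {p : TwoColouredPartition} [NeZero N] {hd : d ≤ N}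
    (hab : ∀ (e e' : Colour) i j i' j', Commute (e.pow (a i j)) (e'.pow (b i' j')))
    (ha : p.SpaceRelations le_rfl a) (hb : p.SpaceRelations hd b) :
    p.SpaceRelations hd (fun i j => ∑ m, a i m * b m j) := by
  choose s hs using fun j : p.ThroughBlock → Fin N => p.rowClass_nonempty Sum.inl j
  choose s' hs' using fun j : p.ThroughBlock → Fin N => p.rowClass_nonempty Sum.inr j
  constructor
  · intro i j γ γ' hγ hγ'
    rw [sum_upperClass_mul p hab ha i hs, sum_lowerClass_mul p hab ha i hs']
    refine Finset.sum_congr rfl fun m _ => ?_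
    rw [ha.valid i m (s m) (s' m) (hs m) (hs' m), hb.valid m j γ γ' hγ hγ']
  · intro i γ hγ
    rw [sum_upperClass_mul p hab ha i hs]
    exact Finset.sum_eq_zero fun m _ => by rw [hb.upper_invalid m γ hγ, mul_zero]
  · intro i γ' hγ'
    rw [sum_lowerClass_mul p hab ha i hs']
    exact Finset.sum_eq_zero fun m _ => by rw [hb.lower_invalid m γ' hγ', mul_zero]

end Products

end TwoColouredPartition


lemma Colour.map_pow {A : Type u} {B : Type v} [Ring A] [StarRing A] [Algebra ℂ A] [Ring B]
    [StarRing B] [Algebra ℂ B] (φ : A →⋆ₐ[ℂ] B) (c : Colour) (a : A) :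
    φ (c.pow a) = c.pow (φ a) := by
  cases c
  · rfl
  · exact map_star φ a

namespace TwoColouredPartition

/-! ### Quantum space relations and ⋆-homomorphisms -/

section Map

variable {N d : ℕ} {A : Type u} [Ring A] [StarRing A] [Algebra ℂ A]
  {B : Type v} [Ring B] [StarRing B] [Algebra ℂ B] (p : TwoColouredPartition)

lemma map_wordMatrix {k : ℕ} (ω : Fin k → Colour) (φ : A →⋆ₐ[ℂ] B) (x : Fin N → Fin d → A)
    (t : Fin k → Fin N) (γ : Fin k → Fin d) :
    φ (wordMatrix ω x t γ) = wordMatrix ω (fun i j => φ (x i j)) t γ := by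
  rw [wordMatrix_apply, map_list_prod, List.map_ofFn, wordMatrix_apply]
  congr 2
  funext a
  exact Colour.map_pow φ _ _

lemma map_upperSum (φ : A →⋆ₐ[ℂ] B) (x : Fin N → Fin d → A) (i : p.ThroughBlock → Fin N)
    (γ : Fin p.k → Fin d) :
    φ (p.upperSum x i γ) = p.upperSum (fun i j => φ (x i j)) i γ := by
  simp only [upperSum_eq, map_sum, map_wordMatrix]

lemma map_lowerSum (φ : A →⋆ₐ[ℂ] B) (x : Fin N → Fin d → A) (i : p.ThroughBlock → Fin N)
    (γ : Fin p.l → Fin d) :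
    φ (p.lowerSum x i γ) = p.lowerSum (fun i j => φ (x i j)) i γ := by
  simp only [lowerSum_eq, map_sum, map_wordMatrix]

variable {p} {hd : d ≤ N}

lemma SpaceRelations.map {x : Fin N → Fin d → A} (h : p.SpaceRelations hd x) (φ : A →⋆ₐ[ℂ] B) :
    p.SpaceRelations hd fun i j => φ (x i j) where
  valid i j γ γ' hγ hγ' := by
    rw [← map_upperSum, ← map_lowerSum, h.valid i j γ γ' hγ hγ']
  upper_invalid i γ hγ := by rw [← map_upperSum, h.upper_invalid i γ hγ, map_zero]
  lower_invalid i γ' hγ' := by rw [← map_lowerSum, h.lower_invalid i γ' hγ', map_zero]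

/-- The quantum space relations can be tested on a separating family of ⋆-homomorphisms. -/
lemma spaceRelations_of_separating {x : Fin N → Fin d → A}
    (h : ∀ a : A, a ≠ 0 → ∃ (B : Type v) (_ : CStarAlgebra B) (φ : A →⋆ₐ[ℂ] B), φ a ≠ 0 ∧
      p.SpaceRelations hd fun i j => φ (x i j)) :
    p.SpaceRelations hd x := by
  constructor
  · intro i j γ γ' hγ hγ'
    by_contra hne
    obtain ⟨B, _, φ, hφ, hx⟩ := h _ (sub_ne_zero.2 hne)
    apply hφ
    rw [map_sub, map_upperSum, map_lowerSum, hx.valid i j γ γ' hγ hγ', sub_self]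
  · intro i γ hγ
    by_contra hne
    obtain ⟨B, _, φ, hφ, hx⟩ := h _ hne
    exact hφ (by rw [map_upperSum, hx.upper_invalid i γ hγ])
  · intro i γ' hγ'
    by_contra hne
    obtain ⟨B, _, φ, hφ, hx⟩ := h _ hne
    exact hφ (by rw [map_lowerSum, hx.lower_invalid i γ' hγ'])

end Map

/-- The unit matrix satisfies the quantum space relations of every partition. -/
lemma spaceRelations_one {N : ℕ} [NeZero N] {A : Type u} [Ring A] [StarRing A] [Algebra ℂ A]
    (p : TwoColouredPartition) :
    p.SpaceRelations le_rfl fun i j : Fin N => if i = j then (1 : A) else 0 := by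
  have h : ∀ {k : ℕ} (ω : Fin k → Colour),
      wordMatrix ω (fun i j : Fin N => if i = j then (1 : A) else 0) = 1 := by
    intro k ω
    ext t γ
    rw [wordMatrix_apply, Matrix.one_apply]
    split_ifs with htγ
    · subst htγ
      refine List.prod_eq_one fun y hy => ?_
      obtain ⟨a, rfl⟩ := List.mem_ofFn.1 hy
      cases ω a <;> simp [Colour.pow]
    · obtain ⟨a, ha⟩ := Function.ne_iff.1 htγ
      refine List.prod_eq_zero (List.mem_ofFn.2 ⟨a, ?_⟩)
      cases ω a <;> simp [Colour.pow, ha]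
  -- All tensor powers of the unit matrix are unit matrices, which every T_p intertwines.
  refine BlocksIntertwine.spaceRelations ⟨?_, ?_⟩
  · rw [h, h, Matrix.one_mul, Matrix.mul_one]
  · rw [h, h, Matrix.one_mul, Matrix.mul_one]

/-- The generators of a universal C⋆-algebra whose relations imply the quantum space relations
satisfy the quantum space relations. -/
lemma spaceRelations_gen {N d : ℕ} {hd : d ≤ N} {X : Type u} (R : CStarRelations X)
    (f : Fin N → Fin d → X) (p : TwoColouredPartition)
    (h : ∀ (B : Type u) [CStarAlgebra B] (y : X → B), R.Holds B y →
      p.SpaceRelations hd fun i j => y (f i j)) :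
    p.SpaceRelations hd fun i j => R.gen (f i j) := by
  let τ := R.universalSeminorm.toCompletion
  let x : Fin N → Fin d → FreeStarAlgebra X := fun i j => FreeStarAlgebra.of (f i j)
  have hU : ∀ i γ, p.upperSum (fun i j => R.gen (f i j)) i γ = τ (p.upperSum x i γ) :=
    fun i γ => (map_upperSum p τ x i γ).symm
  have hL : ∀ i γ, p.lowerSum (fun i j => R.gen (f i j)) i γ = τ (p.lowerSum x i γ) :=
    fun i γ => (map_lowerSum p τ x i γ).symm
  have heU : ∀ (B : Type u) [CStarAlgebra B] (y : X → B) i γ,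
      FreeStarAlgebra.eval y (p.upperSum x i γ) = p.upperSum (fun i j => y (f i j)) i γ := by
    intro B _ y i γ
    rw [map_upperSum]
    simp only [x, FreeStarAlgebra.eval_of]
  have heL : ∀ (B : Type u) [CStarAlgebra B] (y : X → B) i γ,
      FreeStarAlgebra.eval y (p.lowerSum x i γ) = p.lowerSum (fun i j => y (f i j)) i γ := by
    intro B _ y i γ
    rw [map_lowerSum]
    simp only [x, FreeStarAlgebra.eval_of]
  constructor
  · intro i j γ γ' hγ hγ'
    rw [hU, hL, ← sub_eq_zero, ← map_sub]
    refine R.toCompletion_eq_zero fun B _ y hy => ?_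
    rw [map_sub, heU, heL, (h B y hy).valid i j γ γ' hγ hγ', sub_self]
  · intro i γ hγ
    rw [hU]
    refine R.toCompletion_eq_zero fun B _ y hy => ?_
    rw [heU, (h B y hy).upper_invalid i γ hγ]
  · intro i γ' hγ'
    rw [hL]
    refine R.toCompletion_eq_zero fun B _ y hy => ?_
    rw [heL, (h B y hy).lower_invalid i γ' hγ']

/-- The relations of a pair partition on two lower points. -/
lemma SpaceRelations.sum_lowerPair {N d : ℕ} {hd : d ≤ N} {A : Type u} [Ring A] [StarRing A]
    {c c' : Colour} {x : Fin N → Fin d → A} (h : (lowerPair c c').SpaceRelations hd x)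
    (j j' : Fin d) :
    ∑ t, c.pow (x t j) * c'.pow (x t j') = if j = j' then 1 else 0 := by
  classical
  -- The upper row is empty, so there are no through-blocks and a single class. The upper sum is the
  -- empty product 1.
  have hE : ∀ b : (lowerPair c c').ThroughBlock, False := by
    rintro ⟨b, ⟨a, _⟩, _⟩
    exact a.elim0
  let i : (lowerPair c c').ThroughBlock → Fin N := fun b => (hE b).elim
  let γ : Fin 2 → Fin d := ![j, j']
  have hsum : (lowerPair c c').lowerSum x i γ = ∑ t, c.pow (x t j) * c'.pow (x t j') := by
    unfold lowerSum
    symm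
    refine Finset.sum_bij (fun t _ _ => t) ?_ ?_ ?_ ?_
    · intro t _
      simp only [Finset.mem_filter, Finset.mem_univ, true_and]
      exact ⟨fun _ _ _ => rfl, fun b => (hE b).elim⟩
    · intro t _ t' _ h
      exact congrFun h (0 : Fin 2)
    · intro t ht
      simp only [Finset.mem_filter, Finset.mem_univ, true_and] at ht
      exact ⟨t (0 : Fin 2), Finset.mem_univ _, funext fun a => ht.1 _ _ trivial⟩
    · intro t _
      simp [lowerPair, oneBlock, List.ofFn_succ, γ]
  rw [← hsum]
  split_ifs with hj
  · subst hj
    have hγ : ∀ a, γ a = j := fun a => by fin_cases a <;> rfl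
    refine (h.valid i i (fun a => a.elim0) γ ⟨fun a => a.elim0, fun b => (hE b).elim⟩
      ⟨fun a b _ => ?_, fun b => (hE b).elim⟩).symm.trans ?_
    · exact congrArg _ ((hγ a).trans (hγ b).symm)
    · unfold upperSum
      rw [Finset.sum_eq_single_of_mem (fun a => a.elim0)]
      · simp [lowerPair, oneBlock]
      · simp only [Finset.mem_filter, Finset.mem_univ, true_and]
        exact ⟨fun a => a.elim0, fun b => (hE b).elim⟩
      · intro t _ ht
        exact (ht (funext fun a => a.elim0)).elim
  · exact h.lower_invalid i γ fun hv =>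
      hj (Fin.castLE_injective hd (hv (0 : Fin 2) (1 : Fin 2) trivial))

end TwoColouredPartition

open TwoColouredPartition

/-! ### Unitarity of admissible matrices -/

section Unitary

variable {N : ℕ} {A : Type u} [Ring A] [StarRing A] {P : Set TwoColouredPartition}
  {x : Matrix (Fin N) (Fin N) A}

/-- The mixed pairs give x⋆x = 1 from the relations of `x` and xx⋆ = 1 from those of its transpose.
-/
lemma TwoColouredPartition.Admissible.isUnit (hP : mixedPairs ⊆ P) (h : Admissible P x) :
    IsUnit x := by
  have hwb := h _ (hP (show lowerPair .white .black ∈ mixedPairs by simp [mixedPairs]))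
  have hbw := h _ (hP (show lowerPair .black .white ∈ mixedPairs by simp [mixedPairs]))
  refine ⟨⟨x, x.conjTranspose, ?_, ?_⟩, rfl⟩
  · ext i j
    rw [Matrix.mul_apply, Matrix.one_apply]
    exact hwb.2.sum_lowerPair i j
  · ext i j
    rw [Matrix.mul_apply, Matrix.one_apply]
    exact hbw.1.sum_lowerPair i j

lemma TwoColouredPartition.Admissible.isUnit_conj (hP : mixedPairs ⊆ P) (h : Admissible P x) :
    IsUnit (x.map star) := by
  have hwb := h _ (hP (show lowerPair .white .black ∈ mixedPairs by simp [mixedPairs]))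
  have hbw := h _ (hP (show lowerPair .black .white ∈ mixedPairs by simp [mixedPairs]))
  refine ⟨⟨x.map star, x.transpose, ?_, ?_⟩, rfl⟩
  · ext i j
    rw [Matrix.mul_apply, Matrix.one_apply]
    exact hbw.2.sum_lowerPair i j
  · ext i j
    rw [Matrix.mul_apply, Matrix.one_apply]
    exact hwb.1.sum_lowerPair i j

end Unitary

/-! ### Actions on partition quantum spaces -/

section MinTensorRelations

variable {N d : ℕ} [NeZero N] {hd : d ≤ N} {A B : Type u} [CStarAlgebra A] [CStarAlgebra B]
  {p : TwoColouredPartition}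

lemma TwoColouredPartition.SpaceRelations.minTmul {a : Fin N → Fin N → A} {b : Fin N → Fin d → B}
    (ha : p.SpaceRelations le_rfl a) (hb : p.SpaceRelations hd b) :
    p.SpaceRelations hd fun i j => ∑ k, minTmul (a i k) (b k j) := by
  have h := SpaceRelations.mul (fun e e' i j i' j' => by
    rw [← Colour.map_pow, ← Colour.map_pow]
    exact commute_minTensorLeft_minTensorRight _ _)
    (ha.map (minTensorLeft (B := B))) (hb.map (minTensorRight (A := A)))
  simpa only [minTensorLeft_mul_minTensorRight] using h

/-- The legs are interchanged because the transpose of the matrix of sums ∑ u_ik ⊗ u_kj is the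
product of the transposes in the opposite order. This is the form needed for the transposed half of
the comultiplication. -/
lemma TwoColouredPartition.SpaceRelations.minTmul_flip {a : Fin N → Fin N → A}
    {b : Fin N → Fin d → A} (ha : p.SpaceRelations le_rfl a) (hb : p.SpaceRelations hd b) :
    p.SpaceRelations hd fun i j => ∑ k, _root_.minTmul (b k j) (a i k) := by
  have h := SpaceRelations.mul (fun e e' i j i' j' => by
    rw [← Colour.map_pow, ← Colour.map_pow]
    exact (commute_minTensorLeft_minTensorRight _ _).symm)
    (ha.map (minTensorRight (A := A))) (hb.map (minTensorLeft (B := A)))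
  simpa only [← (commute_minTensorLeft_minTensorRight (A := A) (B := A) _ _).eq,
    minTensorLeft_mul_minTensorRight] using h

end MinTensorRelations

section Actions

variable {N : ℕ} {P : Set TwoColouredPartition} (hP : mixedPairs ⊆ P)

lemma spaceRelations_pqsGen {p : TwoColouredPartition} (hp : p ∈ P) :
    p.SpaceRelations le_rfl (pqsGen.{u} N N le_rfl P hP) :=
  spaceRelations_gen (pqsRelations.{u} N N le_rfl P hP) (fun i j => ⟨(i, j)⟩) p
    fun _ _ _ hy => hy p hp

lemma exists_pqs_lift {B : Type u} [CStarAlgebra B] {y : Fin N → Fin N → B}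
    (hy : ∀ p ∈ P, p.SpaceRelations le_rfl y) :
    ∃ φ : PQS.{u} N N le_rfl P hP →⋆ₐ[ℂ] B, ∀ i j, φ (pqsGen N N le_rfl P hP i j) = y i j := by
  obtain ⟨φ, hφ⟩ := (pqsRelations.{u} N N le_rfl P hP).exists_lift
    (y := fun ij => y ij.down.1 ij.down.2) hy
  exact ⟨φ, fun i j => hφ _⟩

/-- A matrix acting on a partition quantum space satisfies the quantum space relations, as the
partition quantum space contains the unit matrix as a classical point. -/
lemma spaceRelations_of_action [NeZero N] {A : Type u} [CStarAlgebra A] {v : Fin N → Fin N → A}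
    (α : PQS.{u} N N le_rfl P hP →⋆ₐ[ℂ] MinTensor A (PQS.{u} N N le_rfl P hP))
    (hα : ∀ i j, α (pqsGen N N le_rfl P hP i j) =
      ∑ k, minTmul (v i k) (pqsGen N N le_rfl P hP k j))
    {p : TwoColouredPartition} (hp : p ∈ P) : p.SpaceRelations le_rfl v := by
  refine spaceRelations_of_separating.{u, u} fun a ha => ?_
  obtain ⟨H, _, _, _, π, hπ⟩ := exists_representation_ne_zero ha
  have hH : Nontrivial H := by
    by_contra hH
    rw [not_nontrivial_iff_subsingleton] at hH
    exact hπ (ContinuousLinearMap.ext fun _ => Subsingleton.elim _ _)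
  -- The classical point x_ij ↦ δ_ij, represented by scalars on the same space `H`, so that π ⊗ ε is
  -- defined on the minimal tensor product.
  obtain ⟨ε, hε⟩ := exists_pqs_lift (N := N) (B := H →L[ℂ] H) hP
    fun p _ => spaceRelations_one p
  obtain ⟨φ, hφ⟩ := exists_tensorRep_lift π ε
  refine ⟨HilbertTensor H H →L[ℂ] HilbertTensor H H, inferInstance,
    φ.comp minTensorLeft, fun h => hπ (opTensor_one_right_injective (K := H) ?_), ?_⟩
  · rw [← h, StarAlgHom.comp_apply, minTensorLeft_apply, hφ, map_one]
  · have hx : (fun i j => φ.comp minTensorLeft (v i j)) =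
        fun i j => φ.comp α (pqsGen.{u} N N le_rfl P hP i j) := ?_
    · rw [hx]
      exact (spaceRelations_pqsGen.{u} hP hp).map (φ.comp α)
    funext i j
    rw [StarAlgHom.comp_apply, StarAlgHom.comp_apply, hα, map_sum, minTensorLeft_apply, hφ,
      map_one, Finset.sum_eq_single_of_mem j (Finset.mem_univ j)]
    · rw [hφ, hε, if_pos rfl]
    · intro k _ hk
      have h0 : opTensor (π (v i k)) (0 : H →L[ℂ] H) = 0 := by
        simpa using opTensor_smul_right 0 (π (v i k)) (0 : H →L[ℂ] H)
      rw [hφ, hε, if_neg hk, h0]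

/-- A compact matrix quantum group acts on a partition quantum space from both sides if and only if
its matrix is admissible. -/
theorem hasActions_pqsGen_iff [NeZero N] (G : CMQG.{u} N) :
    G.HasActions (pqsGen.{u} N N le_rfl P hP) ↔ Admissible P G.u := by
  constructor
  · rintro ⟨⟨α, hα⟩, β, hβ⟩ p hp
    exact ⟨spaceRelations_of_action hP α hα hp,
      -- The right action is a left action of the transposed matrix.
      spaceRelations_of_action (v := transposed G.u) hP β hβ hp⟩
  · intro h
    exact ⟨exists_pqs_lift hP fun p hp => (h p hp).1.minTmul (spaceRelations_pqsGen.{u} hP hp),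
      exists_pqs_lift hP fun p hp => (h p hp).2.minTmul (spaceRelations_pqsGen.{u} hP hp)⟩

/-! ### The quantum symmetry group -/

variable (N) in
/-- The relations on the entries of an admissible matrix. -/
def admissibleRelations : CStarRelations.{u} (ULift.{u} (Fin N × Fin N)) where
  Holds _ _ y := Admissible P fun i j => y ⟨(i, j)⟩
  bounded x := ⟨1, fun _ _ y hy => norm_le_one_of_spaceRelations le_rfl (fun i j => y ⟨(i, j)⟩)
    (hy _ (hP (by simp [mixedPairs]))).1 x.down.1 x.down.2⟩

variable (N) in
/-- The universal admissible matrix. -/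
def admissibleGen : Matrix (Fin N) (Fin N) (admissibleRelations.{u} N hP).Universal :=
  fun i j => (admissibleRelations.{u} N hP).gen ⟨(i, j)⟩

lemma admissible_admissibleGen : Admissible P (admissibleGen.{u} N hP) := fun p hp =>
  ⟨spaceRelations_gen (admissibleRelations.{u} N hP) (fun i j => ⟨(i, j)⟩) p
      fun _ _ _ hy => (hy p hp).1,
    spaceRelations_gen (admissibleRelations.{u} N hP) (fun i j => ⟨(j, i)⟩) p
      fun _ _ _ hy => (hy p hp).2⟩

lemma exists_admissible_lift {B : Type u} [CStarAlgebra B] {y : Fin N → Fin N → B}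
    (hy : Admissible P y) :
    ∃ φ : (admissibleRelations.{u} N hP).Universal →⋆ₐ[ℂ] B,
      ∀ i j, φ (admissibleGen N hP i j) = y i j := by
  obtain ⟨φ, hφ⟩ := (admissibleRelations.{u} N hP).exists_lift
    (y := fun ij => y ij.down.1 ij.down.2) hy
  exact ⟨φ, fun i j => hφ _⟩

variable (N) in
/-- The maximal compact matrix quantum group with admissible matrix, i.e. the easy quantum group of
the category generated by `P`. -/
def easyQuantumGroup [NeZero N] : CMQG.{u} N where
  carrier := (admissibleRelations.{u} N hP).Universal
  u := admissibleGen N hP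
  generates := by
    rw [← (admissibleRelations.{u} N hP).adjoin_gen_topologicalClosure]
    congr 2
    exact (Equiv.ulift.symm.surjective.range_comp (admissibleRelations.{u} N hP).gen)
  isUnit := (admissible_admissibleGen hP).isUnit hP
  isUnit_conj := (admissible_admissibleGen hP).isUnit_conj hP
  -- By the universal property it is enough that the matrix ∑ u_ik ⊗ u_kj is admissible.
  exists_comul := exists_admissible_lift hP fun p hp =>
    have h := admissible_admissibleGen.{u} (N := N) hP p hp
    ⟨h.1.minTmul h.1, h.2.minTmul_flip h.2⟩

lemma isQuantumSymmetryGroup_easyQuantumGroup [NeZero N] :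
    (easyQuantumGroup.{u} N hP).IsQuantumSymmetryGroup (pqsGen.{u} N N le_rfl P hP) where
  hasActions := (hasActions_pqsGen_iff hP _).2 (admissible_admissibleGen hP)
  maximal G' hG' := exists_admissible_lift hP ((hasActions_pqsGen_iff hP G').1 hG')

end Actions

/-- Both composites of the two homomorphisms fix the generators, hence are identities. -/
lemma CMQG.Same.of_isSubgroup {N : ℕ} {G G' : CMQG.{u} N} (h : G.IsSubgroup G')
    (h' : G'.IsSubgroup G) : G.Same G' := by
  obtain ⟨φ, hφ⟩ := h
  obtain ⟨ψ, hψ⟩ := h'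
  refine ⟨StarAlgEquiv.ofStarAlgHom ψ φ ?_ ?_, hψ⟩
  · refine StarAlgHom.eq_of_eqOn_generators G.generates ?_
    rintro _ ⟨ij, rfl⟩
    simp [hψ, hφ]
  · refine StarAlgHom.eq_of_eqOn_generators G'.generates ?_
    rintro _ ⟨ij, rfl⟩
    simp [hψ, hφ]

end

theorem mainTheorem5 (N : ℕ) (hN : 0 < N) (P P' : Set TwoColouredPartition)
    (hP : TwoColouredPartition.mixedPairs ⊆ P) (hP' : TwoColouredPartition.mixedPairs ⊆ P')
    (h : TwoColouredPartition.generatedCategory P = TwoColouredPartition.generatedCategory P') :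
    (∃ G : CMQG.{u} N, G.IsQuantumSymmetryGroup (pqsGen.{u} N N le_rfl P hP)) ∧
    (∀ G : CMQG.{u} N, G.IsQuantumSymmetryGroup (pqsGen.{u} N N le_rfl P hP) ↔
      G.IsQuantumSymmetryGroup (pqsGen.{u} N N le_rfl P' hP')) ∧
    (∀ G G' : CMQG.{u} N, G.IsQuantumSymmetryGroup (pqsGen.{u} N N le_rfl P hP) →
      G'.IsQuantumSymmetryGroup (pqsGen.{u} N N le_rfl P' hP') → G.Same G') := by
  have : NeZero N := ⟨hN.ne'⟩
  -- The same quantum groups act on both spaces, so a maximal one for either space is maximal for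
  -- the other, and any two maximal ones contain each other.
  have hact : ∀ G : CMQG.{u} N, G.HasActions (pqsGen.{u} N N le_rfl P hP) ↔
      G.HasActions (pqsGen.{u} N N le_rfl P' hP') := fun G =>
    (hasActions_pqsGen_iff hP G).trans
      ((TwoColouredPartition.admissible_congr hP hP' h).trans (hasActions_pqsGen_iff hP' G).symm)
  refine ⟨⟨_, isQuantumSymmetryGroup_easyQuantumGroup hP⟩, fun G => ?_, fun G G' hG hG' => ?_⟩
  · exact ⟨fun hG => ⟨(hact G).1 hG.hasActions, fun G' hG' => hG.maximal G' ((hact G').2 hG')⟩,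
      fun hG => ⟨(hact G).2 hG.hasActions, fun G' hG' => hG.maximal G' ((hact G').1 hG')⟩⟩
  · exact CMQG.Same.of_isSubgroup (hG'.maximal G ((hact G).1 hG.hasActions))
      (hG.maximal G' ((hact G').2 hG'.hasActions))
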